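/- **Setting.** For each sample size $n$ let $Z_i=(X_i,Y_i)$, $i=1,\dots,n$, be independent (not necessarily identically distributed) with values in $\mathcal X\times\mathcal Y$, $\mathcal Y\subseteq\mathbb R$. Let $\mathbf F$ be a normed real vector space of functions $f:\mathcal X\to\mathbb R$ with norm $\|\cdot\|$. Let $\rho_f(x,y)=\gamma(y,f(x))+c(f)$ be a loss that is convex in $f\in\mathbf F$ for every $(x,y)$, with $E|\rho_f(Z_i)|<\infty$. Put $P_n\rho_f=\frac1n\sum_i\rho_f(Z_i)$ and $P\rho_f=\frac1n\sum_iE\rho_f(Z_i)$, let $f^0\in\mathbf F$ minimize $P\rho_f$ over $\mathbf F$, and let $\Xi(f)=P\rho_f-P\rho_{f^0}$. Let $\psi_1,\dots,\psi_p\in\mathbf F$ with $p=p_n$, $f_\beta=\sum_j\beta_j\psi_j$, and let $\Phi\subseteq\mathbb R^p$ be convex. The elastic net estimator is $\hat f=f_{\hat\beta}$ with $$\hat\beta\in\arg\min_{\beta\in\Phi}\{P_n\rho_{f_\beta}+\lambda_1\|\beta\|_1+\lambda_2\|\beta\|_2^2\}.$$ Let $G$ be strictly convex on $[0,\infty)$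 with $G(0)=0$, not depending on $n$, and $H(v)=\sup_{u\ge0}\{uv-G(u)\}\in[0,\infty]$. For $\beta\in\mathbb R^p$ let $S_\beta=\{j:\beta_j\ne0\}$, $s_\beta=|S_\beta|$, $L(\beta)=3(\sqrt{s_\beta}+2\lambda_2\|\beta\|_2/\lambda_1)$, and $$\phi(S_\beta)^2=\min\{\|f_\delta\|^2/\|\delta_{S_\beta}\|_2^2:\ \delta\ne0,\ \|\delta_{S_\beta^c}\|_1\le L(\beta)\|\delta_{S_\beta}\|_2\}$$ (equal to $\infty$ if $S_\beta=\emptyset$). Let $\Gamma$ be a collection of subsets of $\{1,\dots,p\}$, and let the oracle $\beta^*$ minimize $$3\,\Xi(f_\beta)+2H\big((4\lambda_1\sqrt{s_\beta}+4\lambda_2\|\beta\|_2)/\phi(S_\beta)\big)$$ over $\beta\in\Phi$ with $S_\beta\in\Gamma$. Write $f^*=f_{\beta^*}$, $S^*=S_{\beta^*}$, $s^*=|S^*|$, $\phi_*=\phi(S^*)$, let $2\Delta^*$ be the minimal value, and let $M^*=\Delta^*/\lambda_0$ with $\lambda_0=dD\sqrt{\log(p)/n}$. For $\eta>0$ let $\mathbf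 F_{\rm local}=\{f\in\mathbf F:\sup_x|f(x)-f^0(x)|\le\eta\}$. **Corollary.** For every $K>0$ there is $d_0>0$, depending only on $K$, such that the following holds for every $d\ge d_0$ and all constants $D>0$, $L\ge8$, $a>0$, $b\ge0$ with $a+b<1$. Suppose that, for all large $n$: 1. $\Xi(f)\ge G(\|f-f^0\|)$ for all $f\in\mathbf F_{\rm local}$; 2. $f^*\in\mathbf F_{\rm local}$, and $f_\beta\in\mathbf F_{\rm local}$ for all $\beta\in\mathbb R^p$ with $\|\beta-\beta^*\|_1\le M^*$; 3. $|\gamma(y,f_\beta(x))-\gamma(y,f_{\tilde\beta}(x))|\le D|f_\beta(x)-f_{\tilde\beta}(x)|$ for all $x,y$ and all $\beta,\tilde\beta\in\Phi$; 4. $\frac1n\sum_i\max_jE\psi_j^2(X_i)\le1$ and $\max_j\sup_x|\psi_j(x)|\le K$; 5. $8\lambda_0\le\lambda_1\le L\lambda_0$, $\lambda_2\ge 0$, and $\lambda_2=\lambda_1\sqrt{s^*}/(2\|\beta^*\|_2)$ (no condition but $\lambda_2\ge0$ if $\beta^*=0$). Suppose moreover that $p_n\to\infty$, $p_n=O(\exp(n^a))$,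 $s^*=O(n^b)$, and that $\phi_*$ is bounded away from zero. Then, with probability tending to one, $$\limsup_{n\to\infty}\Xi(\hat f)\le6\limsup_{n\to\infty}\Xi(f^*).$$ That is, there are events $A_n$ with $P(A_n)\to1$ such that the inequality holds along every sequence of outcomes $\omega_n$ with $\omega_n\in A_n$ for all large $n$. The norm $\|\cdot\|$ may also be only a seminorm on $\mathbf F$ (as the $L_2$-norm is on functions that are not identified almost everywhere), provided that $M^*>0$ for all large $n$. -/

import Mathlib

open MeasureTheory ProbabilityTheory Filter Asymptotics
open scoped Topology ENNReal NNReal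

noncomputable section

namespace ElasticNet

universe u v

/-! ### Vectors of coefficients -/

/-- The `ℓ₁`-norm on `ℝ^p`. -/
def l1 {p : ℕ} (β : Fin p → ℝ) : ℝ := ∑ j, |β j|

/-- The `ℓ₂`-norm on `ℝ^p`. -/
def l2 {p : ℕ} (β : Fin p → ℝ) : ℝ := Real.sqrt (∑ j, β j ^ 2)

/-- The support `S_β = {j : β_j ≠ 0}`. -/
def supp {p : ℕ} (β : Fin p → ℝ) : Finset (Fin p) := Finset.univ.filter fun j => β j ≠ 0

/-- `β_S`, the vector with the coordinates outside `S` replaced by zero. -/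
def restr {p : ℕ} (S : Finset (Fin p)) (β : Fin p → ℝ) : Fin p → ℝ :=
  fun j => if j ∈ S then β j else 0

/-! ### Convex conjugate -/

/-- The convex conjugate `H(v) = sup_{u ≥ 0} (u v - G(u))`, `v ≥ 0`, of a function `G` on `[0, ∞)`.
The supremum may be infinite, and `v = ∞` is allowed, so the values are extended reals. -/
def conj (G : ℝ → ℝ) (v : ℝ≥0∞) : EReal :=
  ⨆ u : ℝ≥0, ((((u : ℝ≥0∞) * v : ℝ≥0∞) : EReal) - ((G (u : ℝ) : ℝ) : EReal))

/-! ### The statistical model for one sample size -/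

/-- A sample `Z_i = (X_i, Y_i)`, `i = 1, …, n`, of independent (not necessarily identically
distributed) observations, a real vector space `F` of functions on the covariate space with
a (semi)norm, a convex loss `ρ_f(x, y) = γ(y, f(x)) + c(f)`, a target `f0`, basis functions
`ψ_1, …, ψ_p` in `F`, a convex parameter set `Φ ⊆ ℝ^p` and a collection `Γ` of index sets. -/
structure Setup (n p : ℕ) (Ω : Type u) (𝒳 : Type v) [MeasurableSpace Ω] [MeasurableSpace 𝒳] where
  /-- the underlying probability measure -/
  P : Measure Ω
  isProb : IsProbabilityMeasure P
  /-- the range of the responses -/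
  𝒴 : Set ℝ
  /-- the covariates -/
  X : Fin n → Ω → 𝒳
  /-- the responses -/
  Y : Fin n → Ω → 𝒴
  measurable_X : ∀ i, Measurable (X i)
  measurable_Y : ∀ i, Measurable (Y i)
  indep : iIndepFun (fun i ω => (X i ω, Y i ω)) P
  /-- the function space -/
  F : Submodule ℝ (𝒳 → ℝ)
  /-- the (semi)norm of the function space -/
  nrm : Seminorm ℝ F
  /-- the part of the loss that depends on the observation -/
  γ : 𝒴 → ℝ → ℝ
  /-- the part of the loss that depends on the function only -/
  c : F → ℝ
  measurable_loss : ∀ f : F, Measurable fun z : 𝒳 × 𝒴 => γ z.2 ((f : 𝒳 → ℝ) z.1)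
  integrable_loss : ∀ (f : F) (i : Fin n),
    Integrable (fun ω => γ (Y i ω) ((f : 𝒳 → ℝ) (X i ω))) P
  convex_loss : ∀ (x : 𝒳) (y : 𝒴),
    ConvexOn ℝ Set.univ fun f : F => γ y ((f : 𝒳 → ℝ) x) + c f
  /-- the target function -/
  f0 : F
  /-- the basis functions -/
  ψ : Fin p → F
  measurable_ψ : ∀ j, Measurable (ψ j : 𝒳 → ℝ)
  /-- the parameter set of the estimator -/
  Φ : Set (Fin p → ℝ)
  convex_Φ : Convex ℝ Φ
  /-- the collection of index sets among which the oracle chooses -/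
  Γ : Set (Finset (Fin p))

namespace Setup

variable {n p : ℕ} {Ω : Type u} {𝒳 : Type v} [MeasurableSpace Ω] [MeasurableSpace 𝒳]

/-- The loss `ρ_f(x, y) = γ(y, f(x)) + c(f)`. -/
def loss (M : Setup n p Ω 𝒳) (f : M.F) (x : 𝒳) (y : M.𝒴) : ℝ :=
  M.γ y ((f : 𝒳 → ℝ) x) + M.c f

/-- The empirical risk `P_n ρ_f` at the outcome `ω`. -/
def empRisk (M : Setup n p Ω 𝒳) (f : M.F) (ω : Ω) : ℝ :=
  (1 / (n : ℝ)) * ∑ i, M.loss f (M.X i ω) (M.Y i ω)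

/-- The population risk `P ρ_f = n⁻¹ ∑ E ρ_f(X_i, Y_i)`. -/
def risk (M : Setup n p Ω 𝒳) (f : M.F) : ℝ :=
  (1 / (n : ℝ)) * ∑ i, ∫ ω, M.loss f (M.X i ω) (M.Y i ω) ∂M.P

/-- `f0` minimizes the population risk over `F`. -/
def IsTarget (M : Setup n p Ω 𝒳) : Prop := ∀ f : M.F, M.risk M.f0 ≤ M.risk f

/-- The excess risk `Ξ(f) = P(ρ_f - ρ_{f0})`. -/
def excess (M : Setup n p Ω 𝒳) (f : M.F) : ℝ := M.risk f - M.risk M.f0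

/-- `‖·‖` is a norm on `F` and not only a seminorm. -/
def IsNorm (M : Setup n p Ω 𝒳) : Prop := ∀ f : M.F, M.nrm f = 0 → f = 0

/-- The linear combination `f_β = ∑ β_j ψ_j`. -/
def lin (M : Setup n p Ω 𝒳) (β : Fin p → ℝ) : M.F := ∑ j, β j • M.ψ j

/-- `β` minimizes the empirical risk with the elastic net penalty over `Φ`, at the outcome `ω`. -/
def IsElasticNet (M : Setup n p Ω 𝒳) (lam1 lam2 : ℝ) (ω : Ω) (β : Fin p → ℝ) : Prop :=
  β ∈ M.Φ ∧ ∀ b ∈ M.Φ,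
    M.empRisk (M.lin β) ω + lam1 * l1 β + lam2 * l2 β ^ 2
      ≤ M.empRisk (M.lin b) ω + lam1 * l1 b + lam2 * l2 b ^ 2

/-- `F_local`, the functions of `F` at supremum distance at most `η` from the target. -/
def Flocal (M : Setup n p Ω 𝒳) (η : ℝ) : Set M.F :=
  {f | ∀ x, |(f : 𝒳 → ℝ) x - (M.f0 : 𝒳 → ℝ) x| ≤ η}

/-- The margin inequality `Ξ(f) ≥ G(‖f - f0‖)` on `F_local`. -/
def Margin (M : Setup n p Ω 𝒳) (η : ℝ) (G : ℝ → ℝ) : Prop :=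
  ∀ f ∈ M.Flocal η, G (M.nrm (f - M.f0)) ≤ M.excess f

/-- The constant `L_n = 3 (√|S| + 2 λ₂ ‖b_S‖₂ / λ₁)` that belongs to an index set `S` and
a reference vector `b`. -/
def coneConst (lam1 lam2 : ℝ) (S : Finset (Fin p)) (b : Fin p → ℝ) : ℝ :=
  3 * (Real.sqrt (S.card : ℝ) + 2 * lam2 * l2 (restr S b) / lam1)

/-- The squared adaptive restricted eigenvalue: the minimum of `‖f_δ‖² / ‖δ_S‖₂²` over all `δ ≠ 0`
with `‖δ_{Sᶜ}‖₁ ≤ L_n ‖δ_S‖₂` (these have `δ_S ≠ 0`; the value is `∞` if there are none,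
that is, if `S = ∅`). -/
def phiSq (M : Setup n p Ω 𝒳) (lam1 lam2 : ℝ) (S : Finset (Fin p)) (b : Fin p → ℝ) : ℝ≥0∞ :=
  ⨅ δ ∈ {δ : Fin p → ℝ | δ ≠ 0 ∧ l1 (restr Sᶜ δ) ≤ coneConst lam1 lam2 S b * l2 (restr S δ)},
    ENNReal.ofReal (M.nrm (M.lin δ) ^ 2) / ENNReal.ofReal (l2 (restr S δ) ^ 2)

/-- `φ(S_β)`, with `L_n` formed at `β`. -/
def phi (M : Setup n p Ω 𝒳) (lam1 lam2 : ℝ) (β : Fin p → ℝ) : ℝ≥0∞ :=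
  (M.phiSq lam1 lam2 (supp β) β) ^ (1 / 2 : ℝ)

/-- The oracle's objective `3 Ξ(f_β) + 2 H((4 λ₁ √s_β + 4 λ₂ ‖β‖₂) / φ(S_β))`; it is `∞` for
`β ≠ 0` with `φ(S_β) = 0`. -/
def oracleObj (M : Setup n p Ω 𝒳) (G : ℝ → ℝ) (lam1 lam2 : ℝ) (β : Fin p → ℝ) : EReal :=
  3 * ((M.excess (M.lin β) : ℝ) : EReal) +
    2 * conj G (ENNReal.ofReal
      (4 * lam1 * Real.sqrt ((supp β).card : ℝ) + 4 * lam2 * l2 β) / M.phi lam1 lam2 β)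

/-- `β` is an oracle: it minimizes the objective over the parameters with support in `Γ`. -/
def IsOracle (M : Setup n p Ω 𝒳) (G : ℝ → ℝ) (lam1 lam2 : ℝ) (β : Fin p → ℝ) : Prop :=
  β ∈ M.Φ ∧ supp β ∈ M.Γ ∧
    ∀ b ∈ M.Φ, supp b ∈ M.Γ → M.oracleObj G lam1 lam2 β ≤ M.oracleObj G lam1 lam2 b

/-- `M* = Δ* / λ₀`, where `2 Δ*` is the value of the oracle's objective at `β`. -/
def Mstar (M : Setup n p Ω 𝒳) (G : ℝ → ℝ) (lam0 lam1 lam2 : ℝ) (β : Fin p → ℝ) : EReal :=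
  M.oracleObj G lam1 lam2 β / 2 / (lam0 : EReal)

/-- `f_{β*}`, and `f_b` for every `b` with `‖b - β*‖₁ ≤ M*`, belong to `F_local`. -/
def LocalOracle (M : Setup n p Ω 𝒳) (η : ℝ) (G : ℝ → ℝ) (lam0 lam1 lam2 : ℝ)
    (β : Fin p → ℝ) : Prop :=
  M.lin β ∈ M.Flocal η ∧
    ∀ b : Fin p → ℝ, ((l1 (b - β) : ℝ) : EReal) ≤ M.Mstar G lam0 lam1 lam2 β →
      M.lin b ∈ M.Flocal η

/-- The loss is Lipschitz in its second argument, with constant `D`, over `{f_β : β ∈ Φ}`. -/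
def LipschitzLoss (M : Setup n p Ω 𝒳) (D : ℝ) : Prop :=
  ∀ (x : 𝒳) (y : M.𝒴), ∀ β ∈ M.Φ, ∀ b ∈ M.Φ,
    |M.γ y ((M.lin β : 𝒳 → ℝ) x) - M.γ y ((M.lin b : 𝒳 → ℝ) x)|
      ≤ D * |(M.lin β : 𝒳 → ℝ) x - (M.lin b : 𝒳 → ℝ) x|

/-- `n⁻¹ ∑_i max_j E ψ_j²(X_i) ≤ 1`. -/
def SecondMoment (M : Setup n p Ω 𝒳) : Prop :=
  (1 / (n : ℝ)) * ∑ i, ⨆ j, ∫ ω, (M.ψ j : 𝒳 → ℝ) (M.X i ω) ^ 2 ∂M.P ≤ 1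

/-- `max_j ‖ψ_j‖_∞ ≤ K`. -/
def BoundedBasis (M : Setup n p Ω 𝒳) (K : ℝ) : Prop := ∀ j x, |(M.ψ j : 𝒳 → ℝ) x| ≤ K

end Setup

/-- `λ₀ = d D √(log p / n)`. -/
def lambda0 (d D : ℝ) (n p : ℕ) : ℝ := d * D * Real.sqrt (Real.log p / n)

end ElasticNet

end

namespace ElasticNet

/-! ### Contraction and symmetrization in exponential form -/

/-! The proof is a localized oracle inequality at each large sample size, with an error that
vanishes. Write `v` for the argument of the conjugate at the oracle. Suppose that the margin
inequality linearizes to `v‖f - f⁰‖ ≤ Ξ(f) + h` on the local class, and that on an `ℓ₁`-ball of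
radius `m` around `β*` the fluctuation of the empirical risk is at most `λ₀ m`, where `3/2 Ξ(f*) + h
≤ λ₀ m`. Comparing the objectives at estimator and oracle, and splitting according to whether their
difference lies in the cone of the restricted eigenvalue, gives `Ξ(f̂) ≤ 4 λ₀ m`. Convexity of the
objective removes the need to know beforehand that the estimator lies in the ball
(`oracle_inequality_local`, `oracle_inequality`). Taking `λ₀ m` within `ε` of `3/2 Ξ(f*) + h`
produces the factor 6 and the error `4(h + ε)`.

The fluctuation bound (`exists_event_fluct_le`) is obtained by bounding the exponential moment of
the supremum itself. Observations are symmetrized and contracted one at a time, so that the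
Lipschitz increments are replaced by a linear process. On the `ℓ₁`-ball that process is controlled
by its `p` coordinates, and each observation costs one sub-Gaussian factor. The failure probability
is at most `2/p` once `d ≥ 4K`.

The error vanishes because `v → 0`: the tuning makes `v` at most a constant times `λ₀√s*`, and `a +
b < 1`. No continuity of the conjugate is needed. If `H(c) ≤ C` for one `c > 0`, scaling `c u ≤ G(u)
+ C` by `v/c ≤ 1` gives `h ≤ vC/c` (`conjArg_mul_nrm_le`). Such a `c` exists because an infinite
`M*` at a nonzero oracle would make a whole line of functions local, which forces `f* = 0` and then
`φ_* = 0` (`mstar_ne_top`). -/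

theorem exp_increment_le {q q' r r' : ℝ} (hq : q ≤ q') (hr : 0 ≤ r) (hr' : r ≤ r') :
    Real.exp (q + r) - Real.exp q ≤ Real.exp (q' + r') - Real.exp q' := by
  have h1 : Real.exp q ≤ Real.exp q' := Real.exp_le_exp.2 hq
  have h2 : Real.exp r ≤ Real.exp r' := Real.exp_le_exp.2 hr'
  have h3 : 1 ≤ Real.exp r := Real.one_le_exp hr
  rw [Real.exp_add, Real.exp_add]
  nlinarith [Real.exp_pos q, Real.exp_pos q']

theorem exp_add_exp_neg_le {h x : ℝ} (hx : |h| ≤ |x|) :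
    Real.exp h + Real.exp (-h) ≤ Real.exp x + Real.exp (-x) := by
  have := Real.cosh_le_cosh.2 hx
  rw [Real.cosh_eq, Real.cosh_eq] at this
  linarith

/-- The two-point comparison behind the contraction principle. -/
theorem exp_contraction_pair {S T a b h k x y : ℝ} (hx : |h| ≤ |x|) (hy : |k| ≤ |y|)
    (hxy : |h - k| ≤ |x - y|)
    (hS1 : Real.exp (a + x) ≤ S) (hS2 : Real.exp (b + y) ≤ S)
    (hT1 : Real.exp (a - x) ≤ T) (hT2 : Real.exp (b - y) ≤ T) :
    Real.exp (a + h) + Real.exp (b - k) ≤ S + T := by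
  -- When either comparison fails, both terms on the left are bounded with a single index: `exp
  -- (±k)` or `exp (±h)` share one offset, and monotonicity of `cosh` in the absolute value
  -- finishes.
  rcases lt_or_ge (a + h) (b + k) with c1 | c1
  · have h1 := Real.exp_le_exp.2 c1.le
    have h2 := exp_add_exp_neg_le hy
    have h3 := mul_le_mul_of_nonneg_left h2 (Real.exp_pos b).le
    simp only [mul_add, ← Real.exp_add, ← sub_eq_add_neg] at h3
    linarith
  rcases lt_or_ge (b - k) (a - h) with c2 | c2
  · have h1 := Real.exp_le_exp.2 c2.le
    have h2 := exp_add_exp_neg_le hx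
    have h3 := mul_le_mul_of_nonneg_left h2 (Real.exp_pos a).le
    simp only [mul_add, ← Real.exp_add, ← sub_eq_add_neg] at h3
    linarith
  -- the increments of the exponential are compared on the side of the larger argument
  have key : ∀ x y : ℝ, |h| ≤ |x| → |k| ≤ |y| → |h - k| ≤ |x - y| → 0 ≤ x → 0 ≤ y →
      Real.exp (a + h) + Real.exp (b - k) ≤ Real.exp (a + x) + Real.exp (b - y) ∨
      Real.exp (a + h) + Real.exp (b - k) ≤ Real.exp (b + y) + Real.exp (a - x) := by
    intro x y hx hy hxy x0 y0
    rw [abs_of_nonneg x0] at hx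
    rw [abs_of_nonneg y0] at hy
    have hx' := abs_le.1 hx
    have hy' := abs_le.1 hy
    rcases le_total y x with c | c
    · rw [abs_of_nonneg (sub_nonneg.2 c)] at hxy
      have hk := abs_le.1 hxy
      left
      have := @exp_increment_le (b - y) (a + h) (y - k) (x - h) (by linarith) (by linarith)
        (by linarith)
      rw [show b - y + (y - k) = b - k by ring, show a + h + (x - h) = a + x by ring] at this
      linarith
    · rw [abs_of_nonpos (sub_nonpos.2 c)] at hxy
      have hk := abs_le.1 hxy
      right
      have := @exp_increment_le (a - x) (b - k) (h + x) (y + k) (by linarith) (by linarith)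
        (by linarith)
      rw [show a - x + (h + x) = a + h by ring, show b - k + (y + k) = b + y by ring] at this
      linarith
  have mono : ∀ {s t : ℝ}, s ≤ t → Real.exp s ≤ Real.exp t := fun h => Real.exp_le_exp.2 h
  rcases le_total 0 x with x0 | x0 <;> rcases le_total 0 y with y0 | y0
  -- Only equal signs of `x` and `y` need the increment comparison; for opposite signs each term is
  -- dominated separately, one by `S` or `T` and the other by the same bound or its companion.
  · rcases key x y hx hy hxy x0 y0 with h1 | h1 <;> linarith
  · have hx' := abs_le.1 hx
    have hy' := abs_le.1 hy
    rw [abs_of_nonneg x0] at hx'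
    rw [abs_of_nonpos y0] at hy'
    have h1 : Real.exp (a + h) ≤ Real.exp (a + x) := mono (by linarith)
    have h2 : Real.exp (b - k) ≤ Real.exp (b - y) := mono (by linarith)
    linarith
  · have hx' := abs_le.1 hx
    have hy' := abs_le.1 hy
    rw [abs_of_nonpos x0] at hx'
    rw [abs_of_nonneg y0] at hy'
    have h1 : Real.exp (a + h) ≤ Real.exp (a - x) := mono (by linarith)
    have h2 : Real.exp (b - k) ≤ Real.exp (b + y) := mono (by linarith)
    linarith
  · have := key (-x) (-y) (by rwa [abs_neg]) (by rwa [abs_neg])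
      (by rw [show -x - -y = -(x - y) by ring, abs_neg]; exact hxy) (by linarith) (by linarith)
    simp only [sub_neg_eq_add, ← sub_eq_add_neg] at this
    rcases this with h1 | h1 <;> linarith

/-- The supremum of a countable family of exponentials. -/
noncomputable def expSup (g : ℕ → ℝ) : ℝ≥0∞ := ⨆ t, ENNReal.ofReal (Real.exp (g t))

theorem le_expSup (g : ℕ → ℝ) (t : ℕ) : ENNReal.ofReal (Real.exp (g t)) ≤ expSup g :=
  le_iSup (fun t => ENNReal.ofReal (Real.exp (g t))) t

theorem measurable_expSup {α : Type*} [MeasurableSpace α] {g : ℕ → α → ℝ}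
    (hg : ∀ t, Measurable (g t)) : Measurable fun z => expSup fun t => g t z :=
  Measurable.iSup fun t => (Real.measurable_exp.comp (hg t)).ennreal_ofReal

/-- The two suprema on the left are attained along different indices `s` and `t`, so it suffices to
bound each pair; this is the two-point comparison. Values in `[0, ∞]` make the infinite case
trivial. -/
theorem expSup_contraction (A h x : ℕ → ℝ) (h0 : ∀ t, |h t| ≤ |x t|)
    (hL : ∀ s t, |h s - h t| ≤ |x s - x t|) :
    expSup (fun t => A t + h t) + expSup (fun t => A t - h t)
      ≤ expSup (fun t => A t + x t) + expSup (fun t => A t - x t) := by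
  set S := expSup fun t => A t + x t with hS
  set T := expSup fun t => A t - x t with hT
  by_cases hS' : S = ⊤
  · simp [hS']
  by_cases hT' : T = ⊤
  · simp [hT']
  have e1 : ∀ t, Real.exp (A t + x t) ≤ S.toReal := fun t =>
    (ENNReal.ofReal_le_iff_le_toReal hS').1 (le_expSup (fun t => A t + x t) t)
  have e2 : ∀ t, Real.exp (A t - x t) ≤ T.toReal := fun t =>
    (ENNReal.ofReal_le_iff_le_toReal hT').1 (le_expSup (fun t => A t - x t) t)
  unfold expSup
  rw [ENNReal.iSup_add]
  refine iSup_le fun s => ?_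
  rw [ENNReal.add_iSup]
  refine iSup_le fun t => ?_
  rw [← ENNReal.ofReal_add (Real.exp_pos _).le (Real.exp_pos _).le,
    ← ENNReal.ofReal_toReal hS', ← ENNReal.ofReal_toReal hT',
    ← ENNReal.ofReal_add ENNReal.toReal_nonneg ENNReal.toReal_nonneg]
  exact ENNReal.ofReal_le_ofReal
    (exp_contraction_pair (h0 s) (h0 t) (hL s t) (e1 s) (e1 t) (e2 s) (e2 t))

theorem ofReal_integral_le_lintegral {α : Type*} [MeasurableSpace α] {μ : Measure α}
    {g : α → ℝ} (hg : Integrable g μ) :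
    ENNReal.ofReal (∫ z, g z ∂μ) ≤ ∫⁻ z, ENNReal.ofReal (g z) ∂μ := by
  rw [integral_eq_lintegral_pos_part_sub_lintegral_neg_part hg]
  exact (ENNReal.ofReal_le_ofReal (sub_le_self _ ENNReal.toReal_nonneg)).trans
    ENNReal.ofReal_toReal_le

/-- Jensen's inequality through the tangent line of the exponential at the mean; working with `∫⁻`
avoids assuming that the exponential is integrable. -/
theorem ofReal_exp_sub_integral_le {α : Type*} [MeasurableSpace α] {μ : Measure α}
    [IsProbabilityMeasure μ] {g : α → ℝ} (hg : Integrable g μ) (y : ℝ) :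
    ENNReal.ofReal (Real.exp (y - ∫ z, g z ∂μ)) ≤ ∫⁻ z, ENNReal.ofReal (Real.exp (y - g z)) ∂μ := by
  set m := ∫ z, g z ∂μ with hm
  have hi : Integrable (fun z => Real.exp (y - m) * (1 + (m - g z))) μ :=
    ((integrable_const _).add ((integrable_const _).sub hg)).const_mul _
  have e : ∫ z, Real.exp (y - m) * (1 + (m - g z)) ∂μ = Real.exp (y - m) := by
    have h1 : ∫ z, (m - g z) ∂μ = 0 := by
      rw [integral_sub (integrable_const _) hg]; simp [← hm]
    have h2 : ∫ z, (1 + (m - g z)) ∂μ = 1 := by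
      rw [integral_add (integrable_const _) (by exact (integrable_const _).sub hg), h1]; simp
    rw [integral_const_mul, h2, mul_one]
  calc ENNReal.ofReal (Real.exp (y - m))
      = ENNReal.ofReal (∫ z, Real.exp (y - m) * (1 + (m - g z)) ∂μ) := by rw [e]
    _ ≤ ∫⁻ z, ENNReal.ofReal (Real.exp (y - m) * (1 + (m - g z))) ∂μ :=
      ofReal_integral_le_lintegral hi
    _ ≤ _ := lintegral_mono fun z => ENNReal.ofReal_le_ofReal <| by
      have h1 := Real.add_one_le_exp (m - g z)
      have h2 : Real.exp (y - g z) = Real.exp (y - m) * Real.exp (m - g z) := by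
        rw [← Real.exp_add]; congr 1; ring
      rw [h2]
      exact mul_le_mul_of_nonneg_left (by linarith) (Real.exp_pos _).le

/-- Symmetrization and contraction for a single observation. -/
theorem lintegral_expSup_centered_le {α : Type*} [MeasurableSpace α] {μ : Measure α}
    [IsProbabilityMeasure μ] (A : ℕ → ℝ) {h x : ℕ → α → ℝ}
    (hm : ∀ t, Measurable (h t)) (xm : ∀ t, Measurable (x t)) (hi : ∀ t, Integrable (h t) μ)
    (h0 : ∀ t z, |h t z| ≤ |x t z|) (hL : ∀ s t z, |h s z - h t z| ≤ |x s z - x t z|) :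
    ∫⁻ z, expSup (fun t => A t + (h t z - ∫ w, h t w ∂μ)) ∂μ ≤
      2⁻¹ * ((∫⁻ z, expSup (fun t => A t + 2 * x t z) ∂μ)
        + ∫⁻ z, expSup (fun t => A t - 2 * x t z) ∂μ) := by
  have mp : Measurable fun z => expSup fun t => A t + 2 * h t z :=
    measurable_expSup fun t => ((hm t).const_mul 2).const_add _
  have mn : Measurable fun z => expSup fun t => A t - 2 * h t z :=
    measurable_expSup fun t => ((hm t).const_mul 2).const_sub _
  have xp : Measurable fun z => expSup fun t => A t + 2 * x t z :=
    measurable_expSup fun t => ((xm t).const_mul 2).const_add _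
  -- The mean is replaced by an independent copy `w`, and `2AB ≤ A² + B²` decouples `z` from `w`.
  -- This doubles the increments and leaves an average over the two signs, so no Rademacher
  -- variables are needed.
  have s1 : ∀ z, expSup (fun t => A t + (h t z - ∫ w, h t w ∂μ)) ≤
      ∫⁻ w, 2⁻¹ * (expSup (fun t => A t + 2 * h t z) + expSup (fun t => A t - 2 * h t w)) ∂μ := by
    intro z
    refine iSup_le fun t => ?_
    beta_reduce
    rw [← add_sub_assoc]
    refine (ofReal_exp_sub_integral_le (hi t) _).trans (lintegral_mono fun w => ?_)
    refine le_trans ?_ (mul_le_mul_right (add_le_add (le_expSup _ t) (le_expSup _ t)) _)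
    rw [← ENNReal.ofReal_add (Real.exp_pos _).le (Real.exp_pos _).le,
      show (2⁻¹ : ℝ≥0∞) = ENNReal.ofReal 2⁻¹ by
        rw [ENNReal.ofReal_inv_of_pos two_pos]; simp,
      ← ENNReal.ofReal_mul (by norm_num)]
    refine ENNReal.ofReal_le_ofReal ?_
    have e1 : Real.exp (A t + 2 * h t z) = Real.exp ((A t + 2 * h t z) / 2) ^ 2 := by
      rw [← Real.exp_nat_mul]; congr 1; push_cast; ring
    have e2 : Real.exp (A t - 2 * h t w) = Real.exp ((A t - 2 * h t w) / 2) ^ 2 := by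
      rw [← Real.exp_nat_mul]; congr 1; push_cast; ring
    have e3 : Real.exp (A t + h t z - h t w)
        = Real.exp ((A t + 2 * h t z) / 2) * Real.exp ((A t - 2 * h t w) / 2) := by
      rw [← Real.exp_add]; congr 1; ring
    rw [e1, e2, e3]
    nlinarith [sq_nonneg (Real.exp ((A t + 2 * h t z) / 2) - Real.exp ((A t - 2 * h t w) / 2))]
  calc _ ≤ ∫⁻ z, ∫⁻ w, 2⁻¹ * (expSup (fun t => A t + 2 * h t z)
        + expSup (fun t => A t - 2 * h t w)) ∂μ ∂μ := lintegral_mono s1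
    _ = 2⁻¹ * ∫⁻ z, (expSup (fun t => A t + 2 * h t z) + expSup (fun t => A t - 2 * h t z)) ∂μ := by
      have h1 : ∀ z, ∫⁻ w, 2⁻¹ * (expSup (fun t => A t + 2 * h t z)
          + expSup (fun t => A t - 2 * h t w)) ∂μ = 2⁻¹ * (expSup (fun t => A t + 2 * h t z)
          + ∫⁻ w, expSup (fun t => A t - 2 * h t w) ∂μ) := fun z => by
        rw [lintegral_const_mul' _ _ (by simp), lintegral_add_left measurable_const]
        simp
      simp_rw [h1]
      rw [lintegral_const_mul' _ _ (by simp), lintegral_add_left mp,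
        lintegral_add_left mp]
      simp
    _ ≤ 2⁻¹ * ∫⁻ z, (expSup (fun t => A t + 2 * x t z) + expSup (fun t => A t - 2 * x t z)) ∂μ := by
      refine mul_le_mul_right (lintegral_mono fun z => ?_) _
      refine expSup_contraction A (fun t => 2 * h t z) (fun t => 2 * x t z) (fun t => ?_)
        fun s t => ?_
      · rw [abs_mul, abs_mul]; exact mul_le_mul_of_nonneg_left (h0 t z) (abs_nonneg _)
      · rw [← mul_sub, ← mul_sub, abs_mul, abs_mul]
        exact mul_le_mul_of_nonneg_left (hL s t z) (abs_nonneg _)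
    _ = _ := by rw [lintegral_add_left xp]

/-! ### The maximal inequality for the empirical process -/

theorem l1_nonneg {p : ℕ} (u : Fin p → ℝ) : 0 ≤ l1 u := Finset.sum_nonneg fun _ _ => abs_nonneg _

theorem abs_sum_mul_le {p : ℕ} (u v : Fin p → ℝ) {B : ℝ} (hv : ∀ j, |v j| ≤ B) :
    |∑ j, u j * v j| ≤ l1 u * B := by
  unfold l1
  rw [Finset.sum_mul]
  refine (Finset.abs_sum_le_sum_abs _ _).trans (Finset.sum_le_sum fun j _ => ?_)
  rw [abs_mul]
  exact mul_le_mul_of_nonneg_left (hv j) (abs_nonneg _)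

/-- On an `ℓ₁`-ball a linear functional is at most the radius times its largest coordinate in
absolute value, and a maximum of exponentials is at most their sum. -/
theorem exp_sum_mul_le {p : ℕ} (hp : 0 < p) {u : Fin p → ℝ} {m : ℝ} (hu : l1 u ≤ m)
    (v : Fin p → ℝ) :
    Real.exp (∑ j, u j * v j) ≤ ∑ j, (Real.exp (m * v j) + Real.exp (-(m * v j))) := by
  have : Nonempty (Fin p) := ⟨⟨0, hp⟩⟩
  obtain ⟨k, hk⟩ := Finite.exists_max fun j => |v j|
  have h1 : ∑ j, u j * v j ≤ m * |v k| :=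
    (le_abs_self _).trans ((abs_sum_mul_le u v hk).trans
      (mul_le_mul_of_nonneg_right hu (abs_nonneg _)))
  have h2 : Real.exp (m * |v k|) ≤ Real.exp (m * v k) + Real.exp (-(m * v k)) := by
    rcases abs_choice (v k) with h | h <;> rw [h]
    · linarith [Real.exp_pos (-(m * v k))]
    · rw [mul_neg]; linarith [Real.exp_pos (m * v k)]
  exact (Real.exp_le_exp.2 h1).trans (h2.trans (Finset.single_le_sum
    (f := fun j => Real.exp (m * v j) + Real.exp (-(m * v j)))
    (fun j _ => by positivity) (Finset.mem_univ k)))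

theorem exp_shift_average_le {a y c : ℝ} (hy : |y| ≤ c) :
    2⁻¹ * ((Real.exp (a + 2 * y) + Real.exp (-(a + 2 * y)))
      + (Real.exp (a - 2 * y) + Real.exp (-(a - 2 * y))))
      ≤ Real.exp (2 * c ^ 2) * (Real.exp a + Real.exp (-a)) := by
  have h1 : Real.cosh (2 * y) ≤ Real.exp (2 * c ^ 2) := by
    refine (Real.cosh_le_exp_half_sq _).trans (Real.exp_le_exp.2 ?_)
    have := sq_le_sq' (abs_le.1 hy).1 (abs_le.1 hy).2
    nlinarith
  have h2 : 2⁻¹ * ((Real.exp (a + 2 * y) + Real.exp (-(a + 2 * y)))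
      + (Real.exp (a - 2 * y) + Real.exp (-(a - 2 * y))))
      = Real.cosh (2 * y) * (Real.exp a + Real.exp (-a)) := by
    rw [Real.cosh_eq, show -(a + 2 * y) = -a + -(2 * y) by ring,
      show -(a - 2 * y) = -a + 2 * y by ring, sub_eq_add_neg a]
    simp only [Real.exp_add]
    ring
  rw [h2]
  exact mul_le_mul_of_nonneg_right h1 (by positivity)

/-- The exponential moment of the supremum of a centered empirical process that is indexed by
a countable subset of an `ℓ₁`-ball and is dominated in increments by a linear process. -/
theorem lintegral_expSup_sum_le {n p : ℕ} {Ω α : Type*} [MeasurableSpace Ω] [MeasurableSpace α]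
    {P : Measure Ω} [IsProbabilityMeasure P] {Z : Fin n → Ω → α} (hZ : ∀ i, Measurable (Z i))
    (hI : iIndepFun Z P) (hp : 0 < p) {ψ : Fin p → α → ℝ} (hψ : ∀ j, Measurable (ψ j)) {K m : ℝ}
    (hK : ∀ j z, |ψ j z| ≤ K) {u : ℕ → Fin p → ℝ} (hm : 0 ≤ m) (hu : ∀ t, l1 (u t) ≤ m)
    {h : ℕ → α → ℝ} (hh : ∀ t, Measurable (h t))
    (h0 : ∀ t z, |h t z| ≤ |∑ j, u t j * ψ j z|)
    (hL : ∀ s t z, |h s z - h t z| ≤ |∑ j, u s j * ψ j z - ∑ j, u t j * ψ j z|)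
    (I : Finset (Fin n)) :
    ∀ v : Fin p → ℝ,
    ∫⁻ ω, expSup (fun t => ∑ j, u t j * v j
        + ∑ i ∈ I, (h t (Z i ω) - ∫ ω', h t (Z i ω') ∂P)) ∂P ≤
      ENNReal.ofReal (Real.exp (2 * (m * K) ^ 2) ^ I.card
        * ∑ j, (Real.exp (m * v j) + Real.exp (-(m * v j)))) := by
  -- Induction over the observations. The statement carries an arbitrary linear term `v` because
  -- removing an observation leaves the term `±2 ∑ u_j ψ_j(z)`, which for fixed `z` is absorbed by
  -- shifting `v`.
  classical
  have xm : ∀ t, Measurable fun z => ∑ j, u t j * ψ j z := fun t =>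
    Finset.measurable_sum _ fun j _ => (hψ j).const_mul _
  induction I using Finset.induction_on with
  | empty =>
    intro v
    simp only [Finset.sum_empty, add_zero, Finset.card_empty, pow_zero, one_mul, lintegral_const,
      measure_univ, mul_one]
    exact iSup_le fun t => ENNReal.ofReal_le_ofReal (exp_sum_mul_le hp (hu t) v)
  | insert i I hi ih =>
    intro v
    set W : Ω → (I → α) := fun ω j => Z j ω with hW
    have hWm : Measurable W := measurable_pi_lambda _ fun j => hZ j
    have hind : IndepFun W (Z i) P := by
      have h1 := hI.indepFun_finset I {i} (Finset.disjoint_singleton_right.2 hi) hZ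
      exact h1.comp measurable_id
        (measurable_pi_apply (⟨i, Finset.mem_singleton_self i⟩ : ({i} : Finset (Fin n))))
    have hmap := (indepFun_iff_map_prod_eq_prod_map_map hWm.aemeasurable
      (hZ i).aemeasurable).1 hind
    have : IsProbabilityMeasure (P.map (Z i)) := Measure.isProbabilityMeasure_map
      (hZ i).aemeasurable
    have : IsProbabilityMeasure (P.map W) := Measure.isProbabilityMeasure_map hWm.aemeasurable
    set A : (Fin p → ℝ) → (I → α) → ℕ → ℝ := fun v w t => ∑ j, u t j * v j
      + ∑ j : I, (h t (w j) - ∫ ω', h t (Z j ω') ∂P) with hA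
    have Am : ∀ v t, Measurable fun w => A v w t := fun v t =>
      (Finset.measurable_sum _ fun (j : I) _ =>
        ((hh t).comp (measurable_pi_apply j)).sub_const _).const_add _
    have hmean : ∀ t, ∫ ω', h t (Z i ω') ∂P = ∫ z, h t z ∂(P.map (Z i)) := fun t =>
      (integral_map (hZ i).aemeasurable (hh t).aestronglyMeasurable).symm
    have hint : ∀ t, Integrable (h t) (P.map (Z i)) := fun t => by
      refine Integrable.of_bound (hh t).aestronglyMeasurable (m * K) (ae_of_all _ fun z => ?_)
      exact (h0 t z).trans ((abs_sum_mul_le _ _ fun j => hK j z).trans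
        (mul_le_mul_of_nonneg_right (hu t) ((abs_nonneg _).trans (hK ⟨0, hp⟩ z))))
    have ih' : ∀ v, ∫⁻ w, expSup (A v w) ∂(P.map W) ≤ ENNReal.ofReal
        (Real.exp (2 * (m * K) ^ 2) ^ I.card
          * ∑ j, (Real.exp (m * v j) + Real.exp (-(m * v j)))) := fun v => by
      rw [lintegral_map (measurable_expSup (Am v)) hWm]
      refine le_trans (le_of_eq ?_) (ih v)
      refine lintegral_congr fun ω => ?_
      simp only [hA, hW]
      congr 1
      funext t
      congr 1
      exact Finset.sum_coe_sort I fun j => h t (Z j ω) - ∫ ω', h t (Z j ω') ∂P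
    have meas : Measurable fun q : (I → α) × α =>
        expSup fun t => A v q.1 t + (h t q.2 - ∫ z, h t z ∂(P.map (Z i))) :=
      measurable_expSup fun t => ((Am v t).comp measurable_fst).add
        (((hh t).comp measurable_snd).sub_const _)
    have e1 : ∫⁻ ω, expSup (fun t => ∑ j, u t j * v j
        + ∑ k ∈ insert i I, (h t (Z k ω) - ∫ ω', h t (Z k ω') ∂P)) ∂P
        = ∫⁻ w, ∫⁻ z, expSup (fun t => A v w t + (h t z - ∫ z, h t z ∂(P.map (Z i))))
            ∂(P.map (Z i)) ∂(P.map W) := by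
      rw [← lintegral_prod _ meas.aemeasurable, ← hmap, lintegral_map meas (hWm.prodMk (hZ i))]
      refine lintegral_congr fun ω => ?_
      congr 1
      funext t
      rw [Finset.sum_insert hi, ← hmean t, ← Finset.sum_coe_sort I]
      simp only [hA, hW]
      ring
    have shift : ∀ (c : ℝ) (z : α), ∫⁻ w, expSup (fun t => A v w t + c * ∑ j, u t j * ψ j z)
        ∂(P.map W) ≤ ENNReal.ofReal (Real.exp (2 * (m * K) ^ 2) ^ I.card
          * ∑ j, (Real.exp (m * (v j + c * ψ j z)) + Real.exp (-(m * (v j + c * ψ j z))))) :=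
      fun c z => by
        refine le_trans (le_of_eq ?_) (ih' fun j => v j + c * ψ j z)
        refine lintegral_congr fun w => ?_
        congr 1
        funext t
        simp only [hA, mul_add, Finset.sum_add_distrib, Finset.mul_sum]
        rw [add_right_comm]
        congr 2
        exact Finset.sum_congr rfl fun j _ => by ring
    have jm : ∀ c : ℝ, Measurable fun q : (I → α) × α =>
        expSup fun t => A v q.1 t + c * ∑ j, u t j * ψ j q.2 := fun c =>
      measurable_expSup fun t => ((Am v t).comp measurable_fst).add
        (((xm t).comp measurable_snd).const_mul _)
    have swap : ∀ c : ℝ, ∫⁻ w, ∫⁻ z, expSup (fun t => A v w t + c * ∑ j, u t j * ψ j z)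
        ∂(P.map (Z i)) ∂(P.map W) = ∫⁻ z, ∫⁻ w, expSup (fun t => A v w t
          + c * ∑ j, u t j * ψ j z) ∂(P.map W) ∂(P.map (Z i)) := fun c =>
      lintegral_lintegral_swap (jm c).aemeasurable
    rw [e1]
    calc _ ≤ ∫⁻ w, 2⁻¹ * ((∫⁻ z, expSup (fun t => A v w t + 2 * ∑ j, u t j * ψ j z) ∂(P.map (Z i)))
          + ∫⁻ z, expSup (fun t => A v w t + (-2) * ∑ j, u t j * ψ j z) ∂(P.map (Z i)))
            ∂(P.map W) := by
          refine lintegral_mono fun w => ?_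
          refine (lintegral_expSup_centered_le (A v w) hh xm hint h0 hL).trans (le_of_eq ?_)
          simp only [neg_mul, sub_eq_add_neg]
      _ = 2⁻¹ * ((∫⁻ z, ∫⁻ w, expSup (fun t => A v w t + 2 * ∑ j, u t j * ψ j z) ∂(P.map W)
            ∂(P.map (Z i)))
          + ∫⁻ z, ∫⁻ w, expSup (fun t => A v w t + (-2) * ∑ j, u t j * ψ j z) ∂(P.map W)
            ∂(P.map (Z i))) := by
          rw [lintegral_const_mul' _ _ (by simp), lintegral_add_left (jm 2).lintegral_prod_right',
            swap 2, swap (-2)]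
      _ = ∫⁻ z, 2⁻¹ * ((∫⁻ w, expSup (fun t => A v w t + 2 * ∑ j, u t j * ψ j z) ∂(P.map W))
          + ∫⁻ w, expSup (fun t => A v w t + (-2) * ∑ j, u t j * ψ j z) ∂(P.map W))
            ∂(P.map (Z i)) := by
          rw [lintegral_const_mul' _ _ (by simp), lintegral_add_left (jm 2).lintegral_prod_left']
      _ ≤ ∫⁻ z, ENNReal.ofReal (Real.exp (2 * (m * K) ^ 2) ^ (insert i I).card
          * ∑ j, (Real.exp (m * v j) + Real.exp (-(m * v j)))) ∂(P.map (Z i)) := by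
          refine lintegral_mono fun z => ?_
          refine (mul_le_mul_right (add_le_add (shift 2 z) (shift (-2) z)) _).trans ?_
          rw [← ENNReal.ofReal_add (by positivity) (by positivity),
            show (2⁻¹ : ℝ≥0∞) = ENNReal.ofReal 2⁻¹ by
              rw [ENNReal.ofReal_inv_of_pos two_pos]; simp,
            ← ENNReal.ofReal_mul (by norm_num)]
          refine ENNReal.ofReal_le_ofReal ?_
          rw [Finset.card_insert_of_notMem hi, pow_succ (Real.exp _), ← mul_add, mul_left_comm, mul_assoc,
            ← Finset.sum_add_distrib]
          refine mul_le_mul_of_nonneg_left ?_ (by positivity)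
          rw [Finset.mul_sum, Finset.mul_sum]
          refine Finset.sum_le_sum fun j _ => ?_
          have hy : |m * ψ j z| ≤ m * K := by
            rw [abs_mul, abs_of_nonneg hm]; exact mul_le_mul_of_nonneg_left (hK j z) hm
          have := @exp_shift_average_le (m * v j) (m * ψ j z) (m * K) hy
          rw [show m * (v j + 2 * ψ j z) = m * v j + 2 * (m * ψ j z) by ring,
            show m * (v j + -2 * ψ j z) = m * v j - 2 * (m * ψ j z) by ring]
          exact this
      _ = _ := by simp

/-- The tail bound for the same process. -/
theorem measure_exists_lt_sum_le {n p : ℕ} {Ω α : Type*} [MeasurableSpace Ω] [MeasurableSpace α]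
    {P : Measure Ω} [IsProbabilityMeasure P] {Z : Fin n → Ω → α} (hZ : ∀ i, Measurable (Z i))
    (hI : iIndepFun Z P) (hp : 0 < p) {ψ : Fin p → α → ℝ} (hψ : ∀ j, Measurable (ψ j)) {K m : ℝ}
    (hK : ∀ j z, |ψ j z| ≤ K) {u : ℕ → Fin p → ℝ} (hm : 0 ≤ m) (hu : ∀ t, l1 (u t) ≤ m)
    {h : ℕ → α → ℝ} (hh : ∀ t, Measurable (h t))
    (h0 : ∀ t z, |h t z| ≤ |∑ j, u t j * ψ j z|)
    (hL : ∀ s t z, |h s z - h t z| ≤ |∑ j, u s j * ψ j z - ∑ j, u t j * ψ j z|) (r : ℝ) :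
    P {ω | ∃ t, r < ∑ i, (h t (Z i ω) - ∫ ω', h t (Z i ω') ∂P)} ≤
      ENNReal.ofReal (2 * p * Real.exp (2 * n * (m * K) ^ 2 - r)) := by
  have key := lintegral_expSup_sum_le hZ hI hp hψ hK hm hu hh h0 hL Finset.univ 0
  have e : Real.exp (2 * (m * K) ^ 2) ^ (Finset.univ : Finset (Fin n)).card
      * ∑ j : Fin p, (Real.exp (m * (0 : Fin p → ℝ) j) + Real.exp (-(m * (0 : Fin p → ℝ) j)))
      = 2 * p * Real.exp (2 * n * (m * K) ^ 2) := by
    rw [← Real.exp_nat_mul]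
    simp only [Pi.zero_apply, mul_zero, neg_zero, Real.exp_zero, Finset.sum_const, Finset.card_univ,
      Fintype.card_fin, nsmul_eq_mul]
    rw [show (n : ℝ) * (2 * (m * K) ^ 2) = 2 * n * (m * K) ^ 2 by ring]
    ring
  rw [e] at key
  simp only [Pi.zero_apply, mul_zero, Finset.sum_const_zero, zero_add] at key
  have hpos : ENNReal.ofReal (Real.exp r) ≠ 0 := by
    simp [Real.exp_pos]
  have mk := meas_ge_le_lintegral_div (μ := P) (f := fun ω => expSup (fun t =>
    ∑ i, (h t (Z i ω) - ∫ ω', h t (Z i ω') ∂P)))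
    (measurable_expSup fun t => Finset.measurable_sum _ fun i _ =>
      ((hh t).comp (hZ i)).sub_const _).aemeasurable hpos ENNReal.ofReal_ne_top
  calc _ ≤ P {ω | ENNReal.ofReal (Real.exp r) ≤ expSup (fun t =>
        ∑ i, (h t (Z i ω) - ∫ ω', h t (Z i ω') ∂P))} := by
        refine measure_mono ?_
        rintro ω ⟨t, ht⟩
        exact (ENNReal.ofReal_le_ofReal (Real.exp_le_exp.2 ht.le)).trans (le_expSup (fun t =>
          ∑ i, (h t (Z i ω) - ∫ ω', h t (Z i ω') ∂P)) t)
    _ ≤ _ := mk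
    _ ≤ ENNReal.ofReal (2 * p * Real.exp (2 * n * (m * K) ^ 2)) / ENNReal.ofReal (Real.exp r) :=
        ENNReal.div_le_div_right key _
    _ = _ := by
        rw [← ENNReal.ofReal_div_of_pos (Real.exp_pos r), Real.exp_sub, mul_div_assoc]

/-! ### Norms of coefficient vectors -/

theorem l2_nonneg {p : ℕ} (u : Fin p → ℝ) : 0 ≤ l2 u := Real.sqrt_nonneg _

theorem l2_sq {p : ℕ} (u : Fin p → ℝ) : l2 u ^ 2 = ∑ j, u j ^ 2 :=
  Real.sq_sqrt (Finset.sum_nonneg fun _ _ => sq_nonneg _)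

theorem l1_smul {p : ℕ} (c : ℝ) (u : Fin p → ℝ) : l1 (c • u) = |c| * l1 u := by
  simp [l1, abs_mul, Finset.mul_sum]

theorem l1_restr_add_l1_restr_compl {p : ℕ} (S : Finset (Fin p)) (u : Fin p → ℝ) :
    l1 (restr S u) + l1 (restr Sᶜ u) = l1 u := by
  unfold l1 restr
  rw [← Finset.sum_add_distrib]
  refine Finset.sum_congr rfl fun j _ => ?_
  by_cases h : j ∈ S <;> simp [h]

theorem l1_restr_le {p : ℕ} (S : Finset (Fin p)) (u : Fin p → ℝ) :
    l1 (restr S u) ≤ Real.sqrt S.card * l2 (restr S u) := by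
  have e1 : l1 (restr S u) = ∑ j ∈ S, |u j| := by
    simp only [l1, restr, apply_ite abs, abs_zero]
    simp
  have e2 : l2 (restr S u) ^ 2 = ∑ j ∈ S, |u j| ^ 2 := by
    rw [l2_sq]
    simp [restr, ite_pow]
  refine (abs_le_of_sq_le_sq' ?_ (mul_nonneg (Real.sqrt_nonneg _) (l2_nonneg _))).2
  rw [mul_pow, Real.sq_sqrt (Nat.cast_nonneg _), e1, e2]
  exact sq_sum_le_card_mul_sum_sq

theorem sum_abs_mul_abs_le {p : ℕ} (u v : Fin p → ℝ) : ∑ j, |u j| * |v j| ≤ l2 u * l2 v := by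
  have := Real.sum_mul_le_sqrt_mul_sqrt Finset.univ (fun j => |u j|) fun j => |v j|
  simpa [l2] using this

theorem restr_supp_self {p : ℕ} (β : Fin p → ℝ) : restr (supp β) β = β := by
  funext j
  by_cases h : β j = 0 <;> simp [restr, supp, h]

/-- Off the support of the reference, the competitor pays its full `ℓ₁`-norm; on the support the
reverse triangle inequality applies. -/
theorem l1_sub_l1_le {p : ℕ} (β b : Fin p → ℝ) :
    l1 β - l1 b ≤ l1 (restr (supp β) (b - β)) - l1 (restr (supp β)ᶜ (b - β)) := by
  unfold l1
  rw [← Finset.sum_sub_distrib, ← Finset.sum_sub_distrib]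
  refine Finset.sum_le_sum fun j _ => ?_
  by_cases h : β j = 0
  · simp [restr, supp, h]
  · have := abs_sub_abs_le_abs_sub (β j) (b j)
    rw [abs_sub_comm] at this
    simpa [restr, supp, h] using this

/-- Expanding the square around `β` and discarding `-(b - β)²` leaves an inner product with `β`,
which sees only the support; then Cauchy–Schwarz. -/
theorem l2_sq_sub_l2_sq_le {p : ℕ} (β b : Fin p → ℝ) :
    l2 β ^ 2 - l2 b ^ 2 ≤ 2 * (l2 β * l2 (restr (supp β) (b - β))) := by
  refine le_trans ?_ (mul_le_mul_of_nonneg_left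
    (sum_abs_mul_abs_le β (restr (supp β) (b - β))) two_pos.le)
  rw [l2_sq, l2_sq, ← Finset.sum_sub_distrib, Finset.mul_sum]
  refine Finset.sum_le_sum fun j _ => ?_
  by_cases h : β j = 0
  · simp [h, sq_nonneg]
  · have h1 : |β j| * |restr (supp β) (b - β) j| = |β j * (b j - β j)| := by
      rw [abs_mul]; simp [restr, supp, h]
    rw [h1]
    nlinarith [neg_abs_le (β j * (b j - β j)), sq_nonneg (b j - β j)]

theorem l1_convex_combination_le {p : ℕ} {t : ℝ} (h0 : 0 ≤ t) (h1 : t ≤ 1) (β b : Fin p → ℝ) :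
    l1 (t • b + (1 - t) • β) ≤ t * l1 b + (1 - t) * l1 β := by
  unfold l1
  rw [Finset.mul_sum, Finset.mul_sum, ← Finset.sum_add_distrib]
  refine Finset.sum_le_sum fun j _ => (abs_add_le _ _).trans (le_of_eq ?_)
  simp [abs_mul, abs_of_nonneg h0, abs_of_nonneg (sub_nonneg.2 h1)]

theorem l2_sq_convex_combination_le {p : ℕ} {t : ℝ} (h0 : 0 ≤ t) (h1 : t ≤ 1)
    (β b : Fin p → ℝ) :
    l2 (t • b + (1 - t) • β) ^ 2 ≤ t * l2 b ^ 2 + (1 - t) * l2 β ^ 2 := by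
  rw [l2_sq, l2_sq, l2_sq, Finset.mul_sum, Finset.mul_sum, ← Finset.sum_add_distrib]
  refine Finset.sum_le_sum fun j _ => ?_
  simp only [Pi.add_apply, Pi.smul_apply, smul_eq_mul]
  nlinarith [mul_nonneg (mul_nonneg h0 (sub_nonneg.2 h1)) (sq_nonneg (b j - β j))]

namespace Setup

variable {n p : ℕ} {Ω : Type*} {𝒳 : Type*} [MeasurableSpace Ω] [MeasurableSpace 𝒳]
  (M : Setup n p Ω 𝒳)

/-! ### The linear predictors and the risks -/

theorem lin_apply (β : Fin p → ℝ) (x : 𝒳) :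
    (M.lin β : 𝒳 → ℝ) x = ∑ j, β j * (M.ψ j : 𝒳 → ℝ) x := by
  simp [lin]

theorem lin_sub (β b : Fin p → ℝ) : M.lin (β - b) = M.lin β - M.lin b := by
  refine Subtype.ext (funext fun x => ?_)
  rw [Submodule.coe_sub, Pi.sub_apply, M.lin_apply, M.lin_apply, M.lin_apply,
    ← Finset.sum_sub_distrib]
  exact Finset.sum_congr rfl fun j _ => sub_mul _ _ _

theorem lin_combination (s t : ℝ) (β b : Fin p → ℝ) :
    M.lin (s • β + t • b) = s • M.lin β + t • M.lin b := by
  simp [lin, add_smul, Finset.sum_add_distrib, Finset.smul_sum, mul_smul]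

theorem lin_smul (s : ℝ) (β : Fin p → ℝ) : M.lin (s • β) = s • M.lin β := by
  simp [lin, Finset.smul_sum, mul_smul]

theorem empRisk_convex_combination_le {t : ℝ} (h0 : 0 ≤ t) (h1 : t ≤ 1) (f g : M.F) (ω : Ω) :
    M.empRisk (t • f + (1 - t) • g) ω ≤ t * M.empRisk f ω + (1 - t) * M.empRisk g ω := by
  unfold empRisk
  rw [mul_left_comm t, mul_left_comm (1 - t), ← mul_add]
  refine mul_le_mul_of_nonneg_left ?_ (by positivity)
  rw [Finset.mul_sum, Finset.mul_sum, ← Finset.sum_add_distrib]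
  refine Finset.sum_le_sum fun i _ => ?_
  exact (M.convex_loss (M.X i ω) (M.Y i ω)).2 (Set.mem_univ f) (Set.mem_univ g) h0
    (sub_nonneg.2 h1) (by ring)

/-- The fluctuation of the empirical risk around the risk. -/
noncomputable def fluct (β : Fin p → ℝ) (ω : Ω) : ℝ := M.empRisk (M.lin β) ω - M.risk (M.lin β)

/-- The elastic net objective. -/
noncomputable def netObj (lam1 lam2 : ℝ) (ω : Ω) (β : Fin p → ℝ) : ℝ :=
  M.empRisk (M.lin β) ω + lam1 * l1 β + lam2 * l2 β ^ 2

theorem netObj_convex_combination_le {lam1 lam2 t : ℝ} (hl1 : 0 ≤ lam1) (hl2 : 0 ≤ lam2)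
    (h0 : 0 ≤ t) (h1 : t ≤ 1) (ω : Ω) (β b : Fin p → ℝ) :
    M.netObj lam1 lam2 ω (t • b + (1 - t) • β)
      ≤ t * M.netObj lam1 lam2 ω b + (1 - t) * M.netObj lam1 lam2 ω β := by
  unfold netObj
  rw [M.lin_combination]
  have e1 := M.empRisk_convex_combination_le h0 h1 (M.lin b) (M.lin β) ω
  have e2 := mul_le_mul_of_nonneg_left (l1_convex_combination_le h0 h1 β b) hl1
  have e3 := mul_le_mul_of_nonneg_left (l2_sq_convex_combination_le h0 h1 β b) hl2
  nlinarith

/-! ### The oracle inequality on a given event -/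

/-- Localized oracle inequality for a parameter whose objective is below that of the reference. -/
theorem oracle_inequality_local {lam0 lam1 lam2 η m v h : ℝ} {ω : Ω} {β b : Fin p → ℝ}
    (hl0 : 0 < lam0) (hl1 : 8 * lam0 ≤ lam1) (hl2 : 0 ≤ lam2) (hm : 0 < m) (hv : 0 ≤ v)
    (hh : 0 ≤ h)
    (htarget : M.IsTarget) (hloc : ∀ b, l1 (b - β) ≤ m → M.lin b ∈ M.Flocal η)
    (hmargin : ∀ f ∈ M.Flocal η, v * M.nrm (f - M.f0) ≤ M.excess f + h)
    (hcone : ∀ δ : Fin p → ℝ,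
      l1 (restr (supp β)ᶜ δ) ≤ coneConst lam1 lam2 (supp β) β * l2 (restr (supp β) δ) →
      (4 * lam1 * Real.sqrt ((supp β).card : ℝ) + 4 * lam2 * l2 β) * l2 (restr (supp β) δ)
        ≤ v * M.nrm (M.lin δ))
    (hq : 3 / 2 * M.excess (M.lin β) + h ≤ lam0 * m)
    (hfluct : M.fluct β ω - M.fluct b ω ≤ lam0 * m)
    (hb : l1 (b - β) ≤ m) (hobj : M.netObj lam1 lam2 ω b ≤ M.netObj lam1 lam2 ω β) :
    l1 (b - β) ≤ m / 2 ∧ M.excess (M.lin b) ≤ 4 * (lam0 * m) := by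
  have hX : ∀ f, 0 ≤ M.excess f := fun f => sub_nonneg.2 (htarget f)
  have hlam1 : 0 < lam1 := by linarith
  set S := supp β with hS
  set g := l2 (restr S (b - β)) with hg
  set r := Real.sqrt (S.card : ℝ) with hr
  have hg0 : 0 ≤ g := l2_nonneg _
  have hr0 : 0 ≤ r := Real.sqrt_nonneg _
  have hsplit := l1_restr_add_l1_restr_compl S (b - β)
  have hCS : l1 (restr S (b - β)) ≤ r * g := l1_restr_le S (b - β)
  have hp1 := mul_le_mul_of_nonneg_left (l1_sub_l1_le β b) hlam1.le
  have hp2 := mul_le_mul_of_nonneg_left (l2_sq_sub_l2_sq_le β b) hl2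
  have hCS' := mul_le_mul_of_nonneg_left hCS hlam1.le
  rw [← hS, ← hg] at hp2
  rw [← hS] at hp1
  have hd0 := l1_nonneg (restr Sᶜ (b - β))
  have hbasic : M.excess (M.lin b) + lam1 * l1 (restr Sᶜ (b - β))
      ≤ lam0 * m + M.excess (M.lin β) + (lam1 * r + 2 * lam2 * l2 β) * g := by
    unfold netObj at hobj
    unfold fluct at hfluct
    unfold excess
    nlinarith
  have hbasic2 : M.excess (M.lin b) + lam1 * l1 (b - β)
      ≤ lam0 * m + M.excess (M.lin β) + (2 * lam1 * r + 2 * lam2 * l2 β) * g := by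
    rw [← hsplit]; nlinarith
  have hXb := hX (M.lin b)
  have hXβ := hX (M.lin β)
  have hl2β : 0 ≤ l2 β := l2_nonneg β
  have hlamg : 0 ≤ lam2 * l2 β * g := by positivity
  have conclude : ∀ c, lam1 * c ≤ 4 * (lam0 * m) → 0 ≤ c → c ≤ m / 2 := by
    intro c hc h0
    have : 8 * lam0 * c ≤ 4 * (lam0 * m) := (mul_le_mul_of_nonneg_right hl1 h0).trans hc
    by_contra! hcon
    nlinarith [mul_lt_mul_of_pos_left hcon hl0]
  -- If the noise and approximation terms are dominated by the penalty term on the support, the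
  -- basic inequality puts `b - β` in the cone, whence the factor 3 in `coneConst`. Otherwise the
  -- penalty term is itself at most `λ₀ m + Ξ(f_β)`, and the restricted eigenvalue is not needed.
  rcases le_or_gt (lam0 * m + M.excess (M.lin β)) (2 * ((lam1 * r + 2 * lam2 * l2 β) * g))
    with hc | hc
  · have hcn : l1 (restr Sᶜ (b - β)) ≤ coneConst lam1 lam2 S β * g := by
      have h1 : lam1 * l1 (restr Sᶜ (b - β)) ≤ 3 * ((lam1 * r + 2 * lam2 * l2 β) * g) := by
        linarith
      have h2 : coneConst lam1 lam2 S β * g = 3 * ((lam1 * r + 2 * lam2 * l2 β) * g) / lam1 := by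
        unfold coneConst
        rw [hS, restr_supp_self, ← hS, ← hr]
        field_simp
      rw [h2, le_div_iff₀ hlam1]
      linarith
    have h1 := hcone _ hcn
    have h2 := hmargin _ (hloc b hb)
    have h3 := hmargin _ (hloc β (by simpa [l1] using hm.le))
    have h4 : M.nrm (M.lin (b - β)) ≤ M.nrm (M.lin b - M.f0) + M.nrm (M.lin β - M.f0) := by
      rw [M.lin_sub, show M.lin b - M.lin β = (M.lin b - M.f0) - (M.lin β - M.f0) by abel]
      exact map_sub_le_add _ _ _
    have h5 := mul_le_mul_of_nonneg_left h4 hv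
    have h6 : (2 * lam1 * r + 2 * lam2 * l2 β) * g
        ≤ 1 / 2 * M.excess (M.lin b) + 1 / 2 * M.excess (M.lin β) + h := by
      have h7 : 2 * ((2 * lam1 * r + 2 * lam2 * l2 β) * g) ≤ v * M.nrm (M.lin (b - β)) :=
        le_trans (le_of_eq (by ring)) h1
      linarith
    refine ⟨conclude _ (by linarith) (l1_nonneg _), ?_⟩
    linarith [mul_nonneg hlam1.le (l1_nonneg (b - β))]
  · have h1 : (2 * lam1 * r + 2 * lam2 * l2 β) * g ≤ lam0 * m + M.excess (M.lin β) := by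
      nlinarith
    refine ⟨conclude _ (by linarith) (l1_nonneg _), ?_⟩
    linarith [mul_nonneg hlam1.le (l1_nonneg (b - β))]

/-- Oracle inequality for the elastic net estimator on the event that the empirical process is
small on an `ℓ₁`-ball around the reference. -/
theorem oracle_inequality {lam0 lam1 lam2 η m v h : ℝ} {ω : Ω} {β b : Fin p → ℝ}
    (hl0 : 0 < lam0) (hl1 : 8 * lam0 ≤ lam1) (hl2 : 0 ≤ lam2) (hm : 0 < m) (hv : 0 ≤ v)
    (hh : 0 ≤ h) (hβ : β ∈ M.Φ)
    (htarget : M.IsTarget) (hloc : ∀ b, l1 (b - β) ≤ m → M.lin b ∈ M.Flocal η)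
    (hmargin : ∀ f ∈ M.Flocal η, v * M.nrm (f - M.f0) ≤ M.excess f + h)
    (hcone : ∀ δ : Fin p → ℝ,
      l1 (restr (supp β)ᶜ δ) ≤ coneConst lam1 lam2 (supp β) β * l2 (restr (supp β) δ) →
      (4 * lam1 * Real.sqrt ((supp β).card : ℝ) + 4 * lam2 * l2 β) * l2 (restr (supp β) δ)
        ≤ v * M.nrm (M.lin δ))
    (hq : 3 / 2 * M.excess (M.lin β) + h ≤ lam0 * m)
    (hfluct : ∀ b ∈ M.Φ, l1 (b - β) ≤ m → M.fluct β ω - M.fluct b ω ≤ lam0 * m)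
    (hnet : M.IsElasticNet lam1 lam2 ω b) :
    M.excess (M.lin b) ≤ 4 * (lam0 * m) := by
  have hobj : M.netObj lam1 lam2 ω b ≤ M.netObj lam1 lam2 ω β := hnet.2 β hβ
  set x := l1 (b - β) with hx
  have hx0 : 0 ≤ x := l1_nonneg _
  -- The interpolated point has distance `m x / (m + x) ≤ m` whatever `x` is, and convexity keeps
  -- its objective below that of `β`. The local bound `m / 2` for it then forces `x ≤ m`, so the
  -- local inequality applies to `b` itself.
  set t := m / (m + x) with ht
  have ht0 : 0 ≤ t := by positivity
  have ht1 : t ≤ 1 := (div_le_one (by positivity)).2 (by linarith)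
  have hdiff : l1 (t • b + (1 - t) • β - β) = t * x := by
    rw [show t • b + (1 - t) • β - β = t • (b - β) by
      funext j; simp only [Pi.sub_apply, Pi.add_apply, Pi.smul_apply, smul_eq_mul]; ring,
      l1_smul, abs_of_nonneg ht0]
  have htx : t * (m + x) = m := by rw [ht]; field_simp
  have hle : l1 (t • b + (1 - t) • β - β) ≤ m := by rw [hdiff]; nlinarith
  have hmem : t • b + (1 - t) • β ∈ M.Φ := M.convex_Φ hnet.1 hβ ht0 (sub_nonneg.2 ht1) (by ring)
  have hobj' : M.netObj lam1 lam2 ω (t • b + (1 - t) • β) ≤ M.netObj lam1 lam2 ω β := by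
    refine (M.netObj_convex_combination_le (by linarith) hl2 ht0 ht1 ω β b).trans ?_
    nlinarith
  have h1 := (M.oracle_inequality_local hl0 hl1 hl2 hm hv hh htarget hloc hmargin hcone hq
    (hfluct _ hmem hle) hle hobj').1
  rw [hdiff] at h1
  have hxm : x ≤ m := by
    by_contra! hcon
    have : m / 2 < t * x := by
      rw [ht, div_mul_eq_mul_div, div_lt_div_iff₀ two_pos (by positivity)]
      nlinarith
    linarith
  exact (M.oracle_inequality_local hl0 hl1 hl2 hm hv hh htarget hloc hmargin hcone hq
    (hfluct _ hnet.1 hxm) hxm hobj).2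

/-! ### The event -/

theorem abs_lin_sub_le {K : ℝ} (hK : M.BoundedBasis K) (β b : Fin p → ℝ) (x : 𝒳) :
    |(M.lin β : 𝒳 → ℝ) x - (M.lin b : 𝒳 → ℝ) x| ≤ l1 (β - b) * K := by
  rw [M.lin_apply, M.lin_apply, ← Finset.sum_sub_distrib]
  simp only [← sub_mul]
  exact abs_sum_mul_le (β - b) _ fun j => hK j x

theorem fluct_sub_fluct (β b : Fin p → ℝ) (ω : Ω) :
    M.fluct β ω - M.fluct b ω = (1 / (n : ℝ)) * ∑ i,
      ((M.γ (M.Y i ω) ((M.lin β : 𝒳 → ℝ) (M.X i ω)) - M.γ (M.Y i ω) ((M.lin b : 𝒳 → ℝ) (M.X i ω)))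
      - ∫ ω', (M.γ (M.Y i ω') ((M.lin β : 𝒳 → ℝ) (M.X i ω'))
        - M.γ (M.Y i ω') ((M.lin b : 𝒳 → ℝ) (M.X i ω'))) ∂M.P) := by
  have := M.isProb
  have e : ∀ (f : M.F) (i : Fin n), ∫ ω', M.loss f (M.X i ω') (M.Y i ω') ∂M.P
      = (∫ ω', M.γ (M.Y i ω') ((f : 𝒳 → ℝ) (M.X i ω')) ∂M.P) + M.c f := fun f i => by
    unfold loss
    rw [integral_add (M.integrable_loss f i) (integrable_const _)]
    simp
  unfold fluct empRisk risk
  simp only [← mul_sub, ← Finset.sum_sub_distrib, e]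
  congr 1
  refine Finset.sum_congr rfl fun i _ => ?_
  rw [integral_sub (M.integrable_loss _ i) (M.integrable_loss _ i)]
  unfold loss
  ring

theorem measurable_fluct (β : Fin p → ℝ) : Measurable (M.fluct β) := by
  unfold fluct empRisk loss
  refine Measurable.sub_const (Measurable.const_mul (Finset.measurable_sum _ fun i _ => ?_) _) _
  exact ((M.measurable_loss (M.lin β)).comp
    ((M.measurable_X i).prodMk (M.measurable_Y i))).add_const _

theorem abs_fluct_sub_fluct_le {D K : ℝ} (hD : 0 ≤ D) (hn : 0 < n) (hL : M.LipschitzLoss D)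
    (hK : M.BoundedBasis K) {β b : Fin p → ℝ} (hβ : β ∈ M.Φ) (hb : b ∈ M.Φ) (ω : Ω) :
    M.fluct β ω - M.fluct b ω ≤ 2 * (D * (l1 (β - b) * K)) := by
  have := M.isProb
  rw [M.fluct_sub_fluct]
  have key : ∀ i ω, |M.γ (M.Y i ω) ((M.lin β : 𝒳 → ℝ) (M.X i ω))
      - M.γ (M.Y i ω) ((M.lin b : 𝒳 → ℝ) (M.X i ω))| ≤ D * (l1 (β - b) * K) := fun i ω =>
    (hL _ _ β hβ b hb).trans (mul_le_mul_of_nonneg_left (M.abs_lin_sub_le hK β b _) hD)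
  have h1 : ∀ i, (M.γ (M.Y i ω) ((M.lin β : 𝒳 → ℝ) (M.X i ω))
        - M.γ (M.Y i ω) ((M.lin b : 𝒳 → ℝ) (M.X i ω)))
      - ∫ ω', (M.γ (M.Y i ω') ((M.lin β : 𝒳 → ℝ) (M.X i ω'))
        - M.γ (M.Y i ω') ((M.lin b : 𝒳 → ℝ) (M.X i ω'))) ∂M.P ≤ 2 * (D * (l1 (β - b) * K)) := by
    intro i
    have h2 := norm_integral_le_of_norm_le_const (μ := M.P)
      (f := fun ω' => M.γ (M.Y i ω') ((M.lin β : 𝒳 → ℝ) (M.X i ω'))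
        - M.γ (M.Y i ω') ((M.lin b : 𝒳 → ℝ) (M.X i ω'))) (ae_of_all _ (key i))
    rw [probReal_univ, mul_one, Real.norm_eq_abs] at h2
    have h3 := (abs_le.1 h2).1
    have h4 := (abs_le.1 (key i ω)).2
    linarith
  have hn' : (0 : ℝ) < n := Nat.cast_pos.2 hn
  calc _ ≤ (1 / (n : ℝ)) * ∑ i : Fin n, 2 * (D * (l1 (β - b) * K)) :=
        mul_le_mul_of_nonneg_left (Finset.sum_le_sum fun i _ => h1 i) (by positivity)
    _ = _ := by
        rw [Finset.sum_const, Finset.card_univ, Fintype.card_fin, nsmul_eq_mul]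
        field_simp

/-- With high probability the empirical process is at most `lam0 * m` on the `ℓ₁`-ball of radius
`m` around `β`. -/
theorem exists_event_fluct_le {D K lam0 m : ℝ} (hD : 0 < D) (hK0 : 0 < K) (hlam0 : 0 < lam0)
    (hm : 0 < m) (hn : 0 < n) (hp : 0 < p) (hL : M.LipschitzLoss D) (hK : M.BoundedBasis K)
    {β : Fin p → ℝ} (hβ : β ∈ M.Φ) :
    ∃ A : Set Ω, MeasurableSet A ∧
      M.P Aᶜ ≤ ENNReal.ofReal (2 * p * Real.exp (-(n * lam0 ^ 2 / (8 * D ^ 2 * K ^ 2)))) ∧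
      ∀ ω ∈ A, ∀ b ∈ M.Φ, l1 (b - β) ≤ m → M.fluct β ω - M.fluct b ω ≤ lam0 * m := by
  have := M.isProb
  have hn' : (0 : ℝ) < n := Nat.cast_pos.2 hn
  let B : Set (Fin p → ℝ) := {b | b ∈ M.Φ ∧ l1 (b - β) ≤ m}
  have hne : Nonempty B := ⟨⟨β, hβ, by simpa [l1] using hm.le⟩⟩
  -- A dense sequence in the ball makes the event measurable and fits the countable maximal
  -- inequality; Lipschitz continuity of the fluctuation later recovers the whole ball.
  let τ : ℕ → B := TopologicalSpace.denseSeq B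
  have hτ : ∀ t, (τ t : Fin p → ℝ) ∈ M.Φ ∧ l1 ((τ t : Fin p → ℝ) - β) ≤ m := fun t => (τ t).2
  refine ⟨{ω | ∀ t, M.fluct β ω - M.fluct (τ t) ω ≤ lam0 * m}, ?_, ?_, ?_⟩
  · rw [Set.ofPred_forall]
    exact MeasurableSet.iInter fun t => measurableSet_le
      ((M.measurable_fluct β).sub (M.measurable_fluct _)) measurable_const
  -- This `σ` minimizes the Chernoff exponent `2n(σDmK)² - σnλ₀m`.
  · set σ := lam0 / (4 * D ^ 2 * m * K ^ 2) with hσ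
    have hσ0 : 0 < σ := by positivity
    let h : ℕ → 𝒳 × M.𝒴 → ℝ := fun t z => σ * (M.γ z.2 ((M.lin β : 𝒳 → ℝ) z.1)
      - M.γ z.2 ((M.lin (τ t) : 𝒳 → ℝ) z.1))
    let u : ℕ → Fin p → ℝ := fun t => (σ * D) • ((τ t : Fin p → ℝ) - β)
    have hu : ∀ t (z : 𝒳 × M.𝒴), ∑ j, u t j * (M.ψ j : 𝒳 → ℝ) z.1 =
        σ * D * ((M.lin (τ t) : 𝒳 → ℝ) z.1 - (M.lin β : 𝒳 → ℝ) z.1) := fun t z => by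
      rw [M.lin_apply, M.lin_apply, ← Finset.sum_sub_distrib, Finset.mul_sum]
      refine Finset.sum_congr rfl fun j _ => ?_
      simp only [u, Pi.smul_apply, Pi.sub_apply, smul_eq_mul]
      ring
    have tail := measure_exists_lt_sum_le (P := M.P) (Z := fun i ω => (M.X i ω, M.Y i ω))
      (fun i => (M.measurable_X i).prodMk (M.measurable_Y i)) M.indep hp
      (ψ := fun j z => (M.ψ j : 𝒳 → ℝ) z.1) (fun j => (M.measurable_ψ j).comp measurable_fst)
      (K := K) (m := σ * D * m) (fun j z => hK j z.1) (u := u) (by positivity)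
      (fun t => by
        rw [l1_smul, abs_of_nonneg (by positivity)]
        exact mul_le_mul_of_nonneg_left (hτ t).2 (by positivity))
      (h := h) (fun t => ((M.measurable_loss _).sub (M.measurable_loss _)).const_mul σ)
      (fun t z => by
        rw [hu]
        simp only [h, abs_mul, abs_of_pos hσ0, abs_of_pos hD, mul_assoc]
        rw [abs_sub_comm ((M.lin (τ t) : 𝒳 → ℝ) z.1)]
        exact mul_le_mul_of_nonneg_left (hL z.1 z.2 β hβ _ (hτ t).1) hσ0.le)
      (fun s t z => by
        rw [hu, hu]
        simp only [h, ← mul_sub, abs_mul, abs_of_pos hσ0, abs_of_pos hD, mul_assoc,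
          sub_sub_sub_cancel_left, sub_sub_sub_cancel_right]
        refine mul_le_mul_of_nonneg_left ?_ hσ0.le
        rw [abs_sub_comm ((M.lin (τ s) : 𝒳 → ℝ) z.1)]
        exact hL z.1 z.2 _ (hτ t).1 _ (hτ s).1)
      (σ * (n * (lam0 * m)))
    have hexp : 2 * (n : ℝ) * (σ * D * m * K) ^ 2 - σ * (n * (lam0 * m))
        = -(n * lam0 ^ 2 / (8 * D ^ 2 * K ^ 2)) := by
      rw [hσ]; field_simp; ring
    rw [hexp] at tail
    refine le_trans (measure_mono ?_) tail
    intro ω hω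
    simp only [Set.mem_compl_iff, Set.mem_ofPred_eq, not_forall, not_le] at hω
    obtain ⟨t, ht⟩ := hω
    refine ⟨t, ?_⟩
    rw [M.fluct_sub_fluct, one_div, inv_mul_eq_div, lt_div_iff₀ hn'] at ht
    simp only [h, integral_const_mul, ← mul_sub, ← Finset.mul_sum]
    refine mul_lt_mul_of_pos_left ?_ hσ0
    linarith
  · intro ω hω b hb hbm
    refine le_of_forall_pos_le_add fun ε hε => ?_
    have hopen : IsOpen {c : B | 2 * (D * (l1 ((c : Fin p → ℝ) - b) * K)) < ε} := by
      refine isOpen_lt ?_ continuous_const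
      unfold l1
      fun_prop
    obtain ⟨t, ht⟩ := (TopologicalSpace.denseRange_denseSeq B).exists_mem_open hopen
      ⟨⟨b, hb, hbm⟩, by simpa [l1] using hε⟩
    have h1 := M.abs_fluct_sub_fluct_le hD.le hn hL hK (hτ t).1 hb ω
    have h2 : M.fluct β ω - M.fluct (τ t) ω ≤ lam0 * m := hω t
    have h3 : 2 * (D * (l1 ((τ t : Fin p → ℝ) - b) * K)) < ε := ht
    linarith

end Setup

/-! ### The convex conjugate -/

theorem conj_nonneg {G : ℝ → ℝ} (hG0 : G 0 = 0) (v : ℝ≥0∞) : 0 ≤ conj G v := by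
  refine le_trans (le_of_eq ?_) (le_iSup (fun u : ℝ≥0 =>
    ((((u : ℝ≥0∞) * v : ℝ≥0∞) : EReal) - ((G (u : ℝ) : ℝ) : EReal))) 0)
  simp [hG0]

theorem fenchel_young {G : ℝ → ℝ} {v : ℝ≥0∞} (hv : v ≠ ⊤) {c : ℝ} (hc : conj G v ≤ (c : EReal))
    {u : ℝ} (hu : 0 ≤ u) : v.toReal * u ≤ G u + c := by
  lift v to ℝ≥0 using hv
  lift u to ℝ≥0 using hu
  have h1 := (le_iSup (fun u : ℝ≥0 =>
    ((((u : ℝ≥0∞) * v : ℝ≥0∞) : EReal) - ((G (u : ℝ) : ℝ) : EReal))) u).trans hc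
  have h2 : (((u : ℝ≥0∞) * v : ℝ≥0∞) : EReal) - ((G (u : ℝ) : ℝ) : EReal)
      = ((u * v - G u : ℝ) : EReal) := by
    rw [← ENNReal.coe_mul, EReal.coe_sub]
    rfl
  have h3 := EReal.coe_le_coe_iff.1 (h2 ▸ h1)
  simp only [ENNReal.coe_toReal]
  linarith [mul_comm (u : ℝ) (v : ℝ)]

/-- Selects a real radius when `M*` may be infinite, and keeps it positive when `q = 0`. -/
theorem exists_pos_le_between {m : EReal} {q ε : ℝ} (hq : 0 ≤ q) (hqm : (q : EReal) ≤ m)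
    (hm : 0 < m) (hε : 0 < ε) : ∃ r : ℝ, 0 < r ∧ q ≤ r ∧ r ≤ q + ε ∧ (r : EReal) ≤ m := by
  induction m with
  | bot => simp at hm
  | top => exact ⟨q + ε, by linarith, by linarith, le_rfl, le_top⟩
  | coe m =>
    have h1 : q ≤ m := EReal.coe_le_coe_iff.1 hqm
    have h2 : 0 < m := by exact_mod_cast hm
    exact ⟨min m (q + ε), lt_min h2 (by linarith), le_min h1 (by linarith), min_le_right _ _,
      EReal.coe_le_coe_iff.2 (min_le_left _ _)⟩

namespace Setup

variable {n p : ℕ} {Ω : Type*} {𝒳 : Type*} [MeasurableSpace Ω] [MeasurableSpace 𝒳]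
  (M : Setup n p Ω 𝒳)

/-! ### The restricted eigenvalue and the radius of the oracle -/

/-- The argument `(4 λ₁ √s_β + 4 λ₂ ‖β‖₂) / φ(S_β)` of the convex conjugate. -/
noncomputable def conjArg (lam1 lam2 : ℝ) (β : Fin p → ℝ) : ℝ≥0∞ :=
  ENNReal.ofReal (4 * lam1 * Real.sqrt ((supp β).card : ℝ) + 4 * lam2 * l2 β) / M.phi lam1 lam2 β

theorem conjArg_ne_top {lam1 lam2 : ℝ} {β : Fin p → ℝ} (hφ : M.phi lam1 lam2 β ≠ 0) :
    M.conjArg lam1 lam2 β ≠ ⊤ :=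
  ENNReal.div_ne_top ENNReal.ofReal_ne_top hφ

theorem phi_le {lam1 lam2 : ℝ} {β δ : Fin p → ℝ} (hg : 0 < l2 (restr (supp β) δ))
    (hδ : l1 (restr (supp β)ᶜ δ) ≤ coneConst lam1 lam2 (supp β) β * l2 (restr (supp β) δ)) :
    M.phi lam1 lam2 β ≤ ENNReal.ofReal (M.nrm (M.lin δ) / l2 (restr (supp β) δ)) := by
  have hδ0 : δ ≠ 0 := by
    rintro rfl
    simp [l2, restr] at hg
  have h1 : M.phiSq lam1 lam2 (supp β) β ≤
      ENNReal.ofReal (M.nrm (M.lin δ) / l2 (restr (supp β) δ)) ^ (2 : ℝ) := by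
    refine (iInf₂_le δ ⟨hδ0, hδ⟩).trans (le_of_eq ?_)
    rw [← ENNReal.ofReal_div_of_pos (by positivity), ← div_pow, ENNReal.rpow_two,
      ENNReal.ofReal_pow (div_nonneg (apply_nonneg _ _) hg.le)]
  refine (ENNReal.rpow_le_rpow h1 (by norm_num : (0 : ℝ) ≤ 1 / 2)).trans (le_of_eq ?_)
  rw [← ENNReal.rpow_mul]
  norm_num

theorem mul_l2_restr_le {lam1 lam2 : ℝ} {β : Fin p → ℝ} (hφ : M.phi lam1 lam2 β ≠ 0)
    (δ : Fin p → ℝ)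
    (hδ : l1 (restr (supp β)ᶜ δ) ≤ coneConst lam1 lam2 (supp β) β * l2 (restr (supp β) δ)) :
    (4 * lam1 * Real.sqrt ((supp β).card : ℝ) + 4 * lam2 * l2 β) * l2 (restr (supp β) δ)
      ≤ (M.conjArg lam1 lam2 β).toReal * M.nrm (M.lin δ) := by
  rcases (l2_nonneg (restr (supp β) δ)).eq_or_lt with hg | hg
  · rw [← hg, mul_zero]
    exact mul_nonneg ENNReal.toReal_nonneg (apply_nonneg _ _)
  have h1 := M.phi_le hg hδ
  have htop : M.phi lam1 lam2 β ≠ ⊤ := ne_top_of_le_ne_top ENNReal.ofReal_ne_top h1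
  have h2 : ENNReal.ofReal (4 * lam1 * Real.sqrt ((supp β).card : ℝ) + 4 * lam2 * l2 β)
      ≤ ENNReal.ofReal ((M.conjArg lam1 lam2 β).toReal
        * (M.nrm (M.lin δ) / l2 (restr (supp β) δ))) := by
    rw [ENNReal.ofReal_mul ENNReal.toReal_nonneg, ENNReal.ofReal_toReal (M.conjArg_ne_top hφ)]
    refine le_trans (le_of_eq ?_) (mul_le_mul_right h1 _)
    rw [conjArg, ENNReal.div_mul_cancel hφ htop]
  rw [ENNReal.ofReal_le_ofReal_iff
    (mul_nonneg ENNReal.toReal_nonneg (div_nonneg (apply_nonneg _ _) hg.le)),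
    ← mul_div_assoc, le_div_iff₀ hg] at h2
  exact h2

theorem conjArg_toReal_le {lam1 lam2 κ : ℝ} {β : Fin p → ℝ} (hκ : 0 < κ)
    (hl1 : 0 ≤ lam1) (hl2 : 0 ≤ lam2)
    (hφ : ENNReal.ofReal κ ≤ M.phi lam1 lam2 β) :
    (M.conjArg lam1 lam2 β).toReal ≤
      (4 * lam1 * Real.sqrt ((supp β).card : ℝ) + 4 * lam2 * l2 β) / κ := by
  have := l2_nonneg β
  refine ENNReal.toReal_le_of_le_ofReal (by positivity) ?_
  rw [ENNReal.ofReal_div_of_pos hκ]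
  exact ENNReal.div_le_div_left hφ _

theorem supp_eq_empty_iff {β : Fin p → ℝ} : supp β = ∅ ↔ β = 0 := by
  simp [supp, Finset.filter_eq_empty_iff, funext_iff]

theorem l2_pos {β : Fin p → ℝ} (hβ : β ≠ 0) : 0 < l2 β := by
  obtain ⟨j, hj⟩ := Function.ne_iff.1 hβ
  exact Real.sqrt_pos.2 (Finset.sum_pos' (fun _ _ => sq_nonneg _)
    ⟨j, Finset.mem_univ j, by have : β j ≠ 0 := hj
                              positivity⟩)

theorem phi_self_le {lam1 lam2 : ℝ} (hl1 : 0 ≤ lam1) (hl2 : 0 ≤ lam2) {β : Fin p → ℝ}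
    (hβ : β ≠ 0) : M.phi lam1 lam2 β ≤ ENNReal.ofReal (M.nrm (M.lin β) / l2 β) := by
  have h0 := l2_pos hβ
  have h := @phi_le n p Ω 𝒳 _ _ M lam1 lam2 β β
  rw [restr_supp_self] at h
  refine h h0 ?_
  have h1 : l1 (restr (supp β)ᶜ β) = 0 := by
    have h2 := l1_restr_add_l1_restr_compl (supp β) β
    rw [restr_supp_self] at h2
    linarith
  rw [h1]
  have := l2_nonneg (restr (supp β) β)
  unfold coneConst
  positivity

theorem conjArg_pos {lam1 lam2 : ℝ} (hl1 : 0 < lam1) (hl2 : 0 ≤ lam2) {β : Fin p → ℝ}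
    (hβ : β ≠ 0) : 0 < M.conjArg lam1 lam2 β := by
  refine ENNReal.div_pos ?_ (ne_top_of_le_ne_top ENNReal.ofReal_ne_top
    (M.phi_self_le hl1.le hl2 hβ))
  have h1 : 0 < (supp β).card := Finset.card_pos.2
    (Finset.nonempty_iff_ne_empty.2 fun h => hβ (supp_eq_empty_iff.1 h))
  have h2 : (0 : ℝ) < (supp β).card := Nat.cast_pos.2 h1
  have h3 := l2_nonneg β
  have h4 := Real.sqrt_pos.2 h2
  have : 0 < 4 * lam1 * Real.sqrt ((supp β).card : ℝ) + 4 * lam2 * l2 β := by positivity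
  simpa using this

theorem mstar_eq (G : ℝ → ℝ) (lam0 lam1 lam2 : ℝ) (β : Fin p → ℝ) :
    M.Mstar G lam0 lam1 lam2 β = (3 * ((M.excess (M.lin β) : ℝ) : EReal)
      + 2 * conj G (M.conjArg lam1 lam2 β)) / 2 / (lam0 : EReal) := rfl

theorem mstar_eq_top {G : ℝ → ℝ} {lam0 lam1 lam2 : ℝ} {β : Fin p → ℝ} (hl0 : 0 < lam0)
    (h : conj G (M.conjArg lam1 lam2 β) = ⊤) : M.Mstar G lam0 lam1 lam2 β = ⊤ := by
  rw [mstar_eq, h, EReal.mul_top_of_pos (by norm_num),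
    show (3 : EReal) * ((M.excess (M.lin β) : ℝ) : EReal)
      = ((3 * M.excess (M.lin β) : ℝ) : EReal) by rw [EReal.coe_mul]; rfl,
    EReal.coe_add_top, EReal.top_div_of_pos_ne_top (by norm_num) (by exact EReal.coe_ne_top 2),
    EReal.top_div_of_pos_ne_top (by exact_mod_cast hl0) (EReal.coe_ne_top _)]

theorem mstar_eq_coe {G : ℝ → ℝ} {lam0 lam1 lam2 c : ℝ} {β : Fin p → ℝ}
    (h : conj G (M.conjArg lam1 lam2 β) = (c : EReal)) :
    M.Mstar G lam0 lam1 lam2 β = (((3 / 2 * M.excess (M.lin β) + c) / lam0 : ℝ) : EReal) := by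
  have e : (3 * M.excess (M.lin β) + 2 * c) / 2 / lam0
      = (3 / 2 * M.excess (M.lin β) + c) / lam0 := by ring
  rw [mstar_eq, h, ← e, EReal.coe_div, EReal.coe_div, EReal.coe_add, EReal.coe_mul, EReal.coe_mul]
  rfl

/-- An infinite radius puts every multiple of `f_β` in a sup-norm ball around `f⁰`, so `f_β = 0`;
testing the restricted eigenvalue at `δ = β` then gives zero. -/
theorem mstar_ne_top {G : ℝ → ℝ} {η lam0 lam1 lam2 : ℝ} {β : Fin p → ℝ}
    (hl1 : 0 ≤ lam1) (hl2 : 0 ≤ lam2) (hβ : β ≠ 0) (hφ : M.phi lam1 lam2 β ≠ 0)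
    (hloc : M.LocalOracle η G lam0 lam1 lam2 β) : M.Mstar G lam0 lam1 lam2 β ≠ ⊤ := by
  intro htop
  have h1 : ∀ t : ℝ, M.lin (t • β) ∈ M.Flocal η := fun t => hloc.2 _ (by rw [htop]; exact le_top)
  have h2 : M.lin β = 0 := by
    refine Subtype.ext (funext fun x => ?_)
    by_contra hx
    have hx' : (M.lin β : 𝒳 → ℝ) x ≠ 0 := hx
    have h3 := h1 ((η + 1 + (M.f0 : 𝒳 → ℝ) x) / (M.lin β : 𝒳 → ℝ) x) x
    rw [M.lin_smul] at h3
    simp only [Submodule.coe_smul, Pi.smul_apply, smul_eq_mul, div_mul_cancel₀ _ hx'] at h3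
    have h4 := (abs_le.1 h3).2
    linarith
  have h3 := M.phi_self_le hl1 hl2 hβ
  rw [h2, map_zero, zero_div, ENNReal.ofReal_zero] at h3
  exact hφ (le_antisymm h3 bot_le)

theorem Margin.mul_nrm_le {M : Setup n p Ω 𝒳} {η : ℝ} {G : ℝ → ℝ} (hM : M.Margin η G) {v : ℝ≥0∞}
    (hv : v ≠ ⊤) {c : ℝ} (hc : conj G v ≤ (c : EReal)) {f : M.F} (hf : f ∈ M.Flocal η) :
    v.toReal * M.nrm (f - M.f0) ≤ M.excess f + c :=
  (fenchel_young hv hc (apply_nonneg _ _)).trans (by linarith [hM f hf])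

/-- If the radius `M*` vanishes and `‖·‖` is a norm, the oracle is the target. -/
theorem lin_eq_target_of_mstar_nonpos {G : ℝ → ℝ} (hG : StrictConvexOn ℝ (Set.Ici 0) G)
    (hG0 : G 0 = 0) {η lam0 lam1 lam2 : ℝ} {β : Fin p → ℝ} (hl0 : 0 < lam0)
    (htarget : M.IsTarget) (hφ : M.phi lam1 lam2 β ≠ 0) (hmargin : M.Margin η G)
    (hβ : M.lin β ∈ M.Flocal η) (hnorm : M.IsNorm) (hM : M.Mstar G lam0 lam1 lam2 β ≤ 0) :
    M.lin β = M.f0 ∧ M.excess (M.lin β) = 0 ∧ conj G (M.conjArg lam1 lam2 β) = 0 := by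
  have hX : 0 ≤ M.excess (M.lin β) := sub_nonneg.2 (htarget _)
  have hH := conj_nonneg hG0 (M.conjArg lam1 lam2 β)
  have hHtop : conj G (M.conjArg lam1 lam2 β) ≠ ⊤ := fun h => by
    rw [M.mstar_eq_top hl0 h] at hM
    simp at hM
  lift conj G (M.conjArg lam1 lam2 β) to ℝ using
    ⟨hHtop, fun h => by rw [h] at hH; simp at hH⟩ with c hc
  rw [M.mstar_eq_coe hc.symm] at hM
  have hc0 : 0 ≤ c := by exact_mod_cast hH
  have h1 : (3 / 2 * M.excess (M.lin β) + c) / lam0 ≤ 0 := by exact_mod_cast hM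
  rw [div_le_iff₀ hl0, zero_mul] at h1
  have hX0 : M.excess (M.lin β) = 0 := by linarith
  have hc0' : c = 0 := by linarith
  refine ⟨?_, hX0, by rw [hc0']; rfl⟩
  -- Nonnegativity of `G` is not assumed; it follows here from the vanishing conjugate. Strict
  -- convexity at the midpoint of `0` and `u` then excludes `G u ≤ 0` for `u > 0`.
  have hGnn : ∀ u, 0 ≤ u → 0 ≤ G u := fun u hu => by
    have := fenchel_young (M.conjArg_ne_top hφ) hc.symm.le hu
    have h3 : 0 ≤ (M.conjArg lam1 lam2 β).toReal * u := mul_nonneg ENNReal.toReal_nonneg hu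
    linarith
  refine sub_eq_zero.1 (hnorm _ ?_)
  by_contra hne
  set u := M.nrm (M.lin β - M.f0) with hu
  have hu0 : 0 < u := lt_of_le_of_ne (apply_nonneg _ _) (Ne.symm hne)
  have h2 : G u ≤ 0 := hX0 ▸ hmargin _ hβ
  have h3 := hG.2 (Set.mem_Ici.2 le_rfl) (Set.mem_Ici.2 hu0.le) hu0.ne
    (by norm_num : (0 : ℝ) < 1 / 2) (by norm_num : (0 : ℝ) < 1 / 2) (by norm_num)
  simp only [smul_eq_mul, mul_zero, zero_add, hG0] at h3
  have h4 := hGnn (1 / 2 * u) (by positivity)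
  linarith

/-- A radius of localization for the oracle inequality. -/
theorem exists_radius {G : ℝ → ℝ} (hG : StrictConvexOn ℝ (Set.Ici 0) G)
    (hG0 : G 0 = 0) {K η lam0 lam1 lam2 ε e : ℝ} {β : Fin p → ℝ} (hK : 0 < K) (hη : 0 < η)
    (hl0 : 0 < lam0) (hε : 0 < ε) (he : 0 ≤ e)
    (htarget : M.IsTarget) (hφ : M.phi lam1 lam2 β ≠ 0) (hmargin : M.Margin η G)
    (hloc : M.LocalOracle η G lam0 lam1 lam2 β)
    (hnorm : M.IsNorm ∨ 0 < M.Mstar G lam0 lam1 lam2 β) (hbdd : M.BoundedBasis K)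
    (hbound : ∀ f ∈ M.Flocal η,
      (M.conjArg lam1 lam2 β).toReal * M.nrm (f - M.f0) ≤ M.excess f + e) :
    ∃ m h : ℝ, 0 < m ∧ 0 ≤ h ∧ h ≤ e ∧
      (∀ f ∈ M.Flocal η, (M.conjArg lam1 lam2 β).toReal * M.nrm (f - M.f0) ≤ M.excess f + h) ∧
      (∀ b, l1 (b - β) ≤ m → M.lin b ∈ M.Flocal η) ∧
      3 / 2 * M.excess (M.lin β) + h ≤ lam0 * m ∧
      lam0 * m ≤ 3 / 2 * M.excess (M.lin β) + h + ε := by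
  have hX : 0 ≤ M.excess (M.lin β) := sub_nonneg.2 (htarget _)
  have hv := M.conjArg_ne_top hφ
  by_cases hpos : 0 < M.Mstar G lam0 lam1 lam2 β
  · have hH := conj_nonneg hG0 (M.conjArg lam1 lam2 β)
    have key : ∃ h : ℝ, 0 ≤ h ∧ h ≤ e ∧ (((3 / 2 * M.excess (M.lin β) + h) / lam0 : ℝ) : EReal)
        ≤ M.Mstar G lam0 lam1 lam2 β ∧ ∀ f ∈ M.Flocal η,
        (M.conjArg lam1 lam2 β).toReal * M.nrm (f - M.f0) ≤ M.excess f + h := by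
      by_cases hHtop : conj G (M.conjArg lam1 lam2 β) = ⊤
      · exact ⟨e, he, le_rfl, by rw [M.mstar_eq_top hl0 hHtop]; exact le_top, hbound⟩
      obtain ⟨c, hc⟩ : ∃ c : ℝ, conj G (M.conjArg lam1 lam2 β) = (c : EReal) :=
        ⟨_, (EReal.coe_toReal hHtop fun h => by rw [h] at hH; simp at hH).symm⟩
      have hc0 : 0 ≤ c := by rw [hc] at hH; exact_mod_cast hH
      -- Both `c` and `e` are valid offsets; the minimum is at most `c`, which keeps the radius
      -- below `M*`, and at most `e`, which vanishes in the limit.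
      refine ⟨min c e, le_min hc0 he, min_le_right _ _, ?_, fun f hf => ?_⟩
      · rw [M.mstar_eq_coe hc]
        refine EReal.coe_le_coe_iff.2 (div_le_div_of_nonneg_right ?_ hl0.le)
        linarith [min_le_left c e]
      · have h1 := hmargin.mul_nrm_le hv hc.le hf
        have h2 := hbound f hf
        rcases min_choice c e with h3 | h3 <;> rw [h3] <;> assumption
    obtain ⟨h, h0, h1, h2, h3⟩ := key
    obtain ⟨m, m0, m1, m2, m3⟩ := exists_pos_le_between (ε := ε / lam0)
      (by positivity) h2 hpos (by positivity)
    refine ⟨m, h, m0, h0, h1, h3, fun b hb => hloc.2 b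
      (le_trans (EReal.coe_le_coe_iff.2 hb) m3), ?_, ?_⟩
    · rw [div_le_iff₀ hl0] at m1; linarith
    · rw [← add_div, le_div_iff₀ hl0] at m2; linarith
  · obtain ⟨h1, h2, h3⟩ := M.lin_eq_target_of_mstar_nonpos hG hG0 hl0 htarget hφ hmargin hloc.1
      (hnorm.resolve_right hpos) (not_lt.1 hpos)
    -- Here `f_β = f⁰`, so any radius up to `η / K` stays local by boundedness of the basis, and `ε
    -- / λ₀` keeps `λ₀ m ≤ ε`.
    refine ⟨min (η / K) (ε / lam0), 0, by positivity, le_rfl, he,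
      fun f hf => hmargin.mul_nrm_le hv (by rw [h3]; rfl) hf, fun b hb x => ?_, ?_, ?_⟩
    · rw [← h1]
      refine (M.abs_lin_sub_le hbdd b β x).trans ?_
      rw [← le_div_iff₀ hK]
      exact hb.trans (min_le_left _ _)
    · rw [h2]; simp only [mul_zero, add_zero]; positivity
    · rw [h2]
      have := (le_div_iff₀ hl0).1 (min_le_right (η / K) (ε / lam0))
      linarith

/-- The oracle inequality for one sample size, with high probability. -/
theorem exists_event_excess_le {G : ℝ → ℝ} (hG : StrictConvexOn ℝ (Set.Ici 0) G)
    (hG0 : G 0 = 0) {D K η lam0 lam1 lam2 ε e : ℝ} {β : Fin p → ℝ} {b : Ω → Fin p → ℝ}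
    (hD : 0 < D) (hK : 0 < K) (hη : 0 < η) (hn : 0 < n) (hp : 0 < p)
    (hl0 : 0 < lam0) (hl1 : 8 * lam0 ≤ lam1) (hl2 : 0 ≤ lam2) (hε : 0 < ε) (he : 0 ≤ e)
    (htarget : M.IsTarget) (hβ : β ∈ M.Φ) (hnet : ∀ᵐ ω ∂M.P, M.IsElasticNet lam1 lam2 ω (b ω))
    (hφ : M.phi lam1 lam2 β ≠ 0) (hmargin : M.Margin η G)
    (hloc : M.LocalOracle η G lam0 lam1 lam2 β)
    (hnorm : M.IsNorm ∨ 0 < M.Mstar G lam0 lam1 lam2 β) (hbdd : M.BoundedBasis K)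
    (hL : M.LipschitzLoss D)
    (hbound : ∀ f ∈ M.Flocal η,
      (M.conjArg lam1 lam2 β).toReal * M.nrm (f - M.f0) ≤ M.excess f + e) :
    ∃ A : Set Ω, MeasurableSet A ∧
      M.P Aᶜ ≤ ENNReal.ofReal (2 * p * Real.exp (-(n * lam0 ^ 2 / (8 * D ^ 2 * K ^ 2)))) ∧
      ∀ ω ∈ A, M.excess (M.lin (b ω)) ≤ 6 * M.excess (M.lin β) + 4 * (e + ε) := by
  obtain ⟨m, h, m0, h0, he', hm, hball, hq, hq'⟩ := M.exists_radius hG hG0 hK hη hl0 hε he htarget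
    hφ hmargin hloc hnorm hbdd hbound
  obtain ⟨A, hA, hPA, hAω⟩ := M.exists_event_fluct_le hD hK hl0 m0 hn hp hL hbdd hβ
  -- The estimator need not be measurable, so the exceptional set is enlarged to a measurable null
  -- set.
  obtain ⟨N, hNsub, hN, hN0⟩ := exists_measurable_superset_of_null (ae_iff.1 hnet)
  refine ⟨A \ N, hA.diff hN, ?_, fun ω hω => ?_⟩
  · rw [Set.sdiff_eq, Set.compl_inter, compl_compl]
    exact (measure_union_le _ _).trans (by rw [hN0, add_zero]; exact hPA)
  · have hnetω : M.IsElasticNet lam1 lam2 ω (b ω) := by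
      by_contra hcon
      exact hω.2 (hNsub hcon)
    have := M.oracle_inequality hl0 hl1 hl2 m0 ENNReal.toReal_nonneg h0 hβ htarget hball hm
      (M.mul_l2_restr_le hφ) hq (hAω ω hω.1) hnetω
    linarith

end Setup

/-! ### Asymptotics -/

theorem lambda0_sq {d D : ℝ} {n p : ℕ} (hp : 1 ≤ p) :
    lambda0 d D n p ^ 2 = d ^ 2 * D ^ 2 * (Real.log p / n) := by
  unfold lambda0
  rw [mul_pow, mul_pow, Real.sq_sqrt]
  exact div_nonneg (Real.log_nonneg (by exact_mod_cast hp)) (Nat.cast_nonneg _)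

theorem lambda0_pos {d D : ℝ} (hd : 0 < d) (hD : 0 < D) {n p : ℕ} (hn : 0 < n) (hp : 2 ≤ p) :
    0 < lambda0 d D n p := by
  have h1 : 0 < Real.log p := Real.log_pos (by exact_mod_cast hp)
  have h2 : (0 : ℝ) < n := Nat.cast_pos.2 hn
  have : 0 < Real.sqrt (Real.log p / n) := Real.sqrt_pos.2 (by positivity)
  unfold lambda0
  positivity

/-- Since `log p = O(n^a)`, the product is `O(n^(a+b-1))`. -/
theorem tendsto_log_div_mul_sparsity {a b : ℝ} (ha : 0 < a) (hab : a + b < 1)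
    {p s : ℕ → ℕ} (hp : Tendsto p atTop atTop)
    (hpO : (fun n => (p n : ℝ)) =O[atTop] fun n : ℕ => Real.exp ((n : ℝ) ^ a))
    (hs : (fun n => (s n : ℝ)) =O[atTop] fun n : ℕ => (n : ℝ) ^ b) :
    Tendsto (fun n : ℕ => Real.log (p n) / n * s n) atTop (𝓝 0) := by
  obtain ⟨C₁, hC₁, h₁⟩ := hpO.exists_pos
  obtain ⟨C₂, hC₂, h₂⟩ := hs.exists_pos
  have hlim : Tendsto (fun n : ℕ => (|Real.log C₁| + 1) * C₂ * (n : ℝ) ^ (-(1 - a - b))) atTop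
      (𝓝 0) := by
    have := ((tendsto_rpow_neg_atTop (show 0 < 1 - a - b by linarith)).comp
      tendsto_natCast_atTop_atTop).const_mul ((|Real.log C₁| + 1) * C₂)
    simpa using this
  refine squeeze_zero' ?_ ?_ hlim
  · filter_upwards [hp.eventually_ge_atTop 1] with n hpn
    exact mul_nonneg (div_nonneg (Real.log_nonneg (by exact_mod_cast hpn)) (Nat.cast_nonneg _))
      (Nat.cast_nonneg _)
  · filter_upwards [hp.eventually_ge_atTop 1, eventually_ge_atTop 1, h₁.bound, h₂.bound]
      with n hpn hn b1 b2
    have hp0 : (0 : ℝ) < p n := by exact_mod_cast hpn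
    have hn1 : (1 : ℝ) ≤ n := by exact_mod_cast hn
    have hn0 : (0 : ℝ) < n := by linarith
    rw [Real.norm_of_nonneg hp0.le, Real.norm_of_nonneg (Real.exp_pos _).le] at b1
    rw [Real.norm_of_nonneg (Nat.cast_nonneg _), Real.norm_of_nonneg (by positivity)] at b2
    have hna : 1 ≤ (n : ℝ) ^ a := Real.one_le_rpow hn1 ha.le
    have hlog : Real.log (p n) ≤ (|Real.log C₁| + 1) * (n : ℝ) ^ a := by
      have h3 := Real.log_le_log hp0 b1
      rw [Real.log_mul hC₁.ne' (Real.exp_pos _).ne', Real.log_exp] at h3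
      nlinarith [le_abs_self (Real.log C₁), abs_nonneg (Real.log C₁)]
    have e : (n : ℝ) ^ (-(1 - a - b)) = (n : ℝ) ^ a / n * (n : ℝ) ^ b := by
      rw [show -(1 - a - b) = a - 1 + b by ring, Real.rpow_add hn0, Real.rpow_sub_one hn0.ne']
    rw [e]
    calc Real.log (p n) / n * s n
        ≤ ((|Real.log C₁| + 1) * (n : ℝ) ^ a) / n * (C₂ * (n : ℝ) ^ b) :=
          mul_le_mul (div_le_div_of_nonneg_right hlog hn0.le) b2 (Nat.cast_nonneg _)
            (by positivity)
      _ = _ := by ring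

/-- The exponent equals `-(d²/(8K²)) log p`, and `d ≥ 4K` makes the factor at least 2, so `2p · p⁻²
= 2/p`. -/
theorem two_mul_exp_neg_le {K d D : ℝ} (hK : 0 < K) (hD : 0 < D) (hd : 4 * K ≤ d) {n p : ℕ}
    (hn : 0 < n) (hp : 1 ≤ p) :
    2 * p * Real.exp (-(n * lambda0 d D n p ^ 2 / (8 * D ^ 2 * K ^ 2))) ≤ 2 / p := by
  have hn' : (0 : ℝ) < n := Nat.cast_pos.2 hn
  have hp' : (0 : ℝ) < p := by exact_mod_cast hp
  have hl : 0 ≤ Real.log p := Real.log_nonneg (by exact_mod_cast hp)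
  have h1 : n * lambda0 d D n p ^ 2 / (8 * D ^ 2 * K ^ 2) = d ^ 2 / (8 * K ^ 2) * Real.log p := by
    rw [lambda0_sq hp]; field_simp
  have h2 : 2 ≤ d ^ 2 / (8 * K ^ 2) := by
    rw [le_div_iff₀ (by positivity)]; nlinarith
  have h3 : Real.exp (-(n * lambda0 d D n p ^ 2 / (8 * D ^ 2 * K ^ 2))) ≤ ((p : ℝ) ^ 2)⁻¹ := by
    rw [h1, Real.exp_neg]
    refine inv_anti₀ (by positivity) ?_
    rw [← Real.exp_log (pow_pos hp' 2), Real.log_pow]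
    refine Real.exp_le_exp.2 ?_
    push_cast
    exact mul_le_mul_of_nonneg_right h2 hl
  refine (mul_le_mul_of_nonneg_left h3 (by positivity)).trans (le_of_eq ?_)
  field_simp

theorem limsup_coe_le_of_eventually_le {x y δ : ℕ → ℝ}
    (h : ∀ᶠ n in atTop, x n ≤ 6 * y n + δ n) (hδ : Tendsto δ atTop (𝓝 0)) :
    limsup (fun n => (x n : EReal)) atTop ≤ 6 * limsup (fun n => (y n : EReal)) atTop := by
  have hδ' : limsup (fun n => (δ n : EReal)) atTop = 0 :=
    (EReal.tendsto_coe.2 hδ).limsup_eq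
  have hmul : limsup (fun n => ((6 * y n : ℝ) : EReal)) atTop
      = 6 * limsup (fun n => (y n : EReal)) atTop := by
    simp only [EReal.coe_mul]
    exact EReal.limsup_const_mul_of_nonneg_of_ne_top (EReal.coe_nonneg.2 (by norm_num))
      (EReal.coe_ne_top 6)
  calc limsup (fun n => (x n : EReal)) atTop
      ≤ limsup ((fun n => ((6 * y n : ℝ) : EReal)) + fun n => (δ n : EReal)) atTop := by
        refine limsup_le_limsup ?_
        filter_upwards [h] with n hn
        rw [Pi.add_apply, ← EReal.coe_add]
        exact EReal.coe_le_coe_iff.2 hn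
    _ ≤ limsup (fun n => ((6 * y n : ℝ) : EReal)) atTop + limsup (fun n => (δ n : EReal)) atTop :=
        EReal.limsup_add_le (by simp [hδ']) (by simp [hδ'])
    _ = _ := by rw [hδ', add_zero, hmul]

/-! ### The linearized margin and the vanishing argument of the conjugate -/

namespace Setup

/-- Where the conjugate is finite at a positive point, the margin holds with a linear function. -/
theorem exists_linear_lower_bound {G : ℝ → ℝ} (hG0 : G 0 = 0) {p : ℕ → ℕ} {Ω 𝒳 : ℕ → Type*}
    [∀ n, MeasurableSpace (Ω n)] [∀ n, MeasurableSpace (𝒳 n)]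
    (M : ∀ n, Setup n (p n) (Ω n) (𝒳 n)) {η lam0 lam1 lam2 : ℕ → ℝ} {β : ∀ n, Fin (p n) → ℝ}
    (hl0 : ∀ᶠ n in atTop, 0 < lam0 n) (hl1 : ∀ᶠ n in atTop, 0 < lam1 n)
    (hl2 : ∀ᶠ n in atTop, 0 ≤ lam2 n)
    (hφ : ∀ᶠ n in atTop, (M n).phi (lam1 n) (lam2 n) (β n) ≠ 0)
    (hloc : ∀ᶠ n in atTop, (M n).LocalOracle (η n) G (lam0 n) (lam1 n) (lam2 n) (β n)) :
    ∃ c C : ℝ, 0 < c ∧ 0 ≤ C ∧ ∀ᶠ n in atTop, β n ≠ 0 → ∀ u, 0 ≤ u → c * u ≤ G u + C := by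
  by_cases hfreq : ∃ᶠ n in atTop, β n ≠ 0
  -- `G` does not depend on `n`, so a single sample size with a nonzero oracle and finite `M*`
  -- supplies `c` and `C` for all the others.
  · obtain ⟨n, hβ, h0, h1, h2, h3, h4⟩ :=
      (hfreq.and_eventually (hl0.and (hl1.and (hl2.and (hφ.and hloc))))).exists
    have hH := conj_nonneg hG0 ((M n).conjArg (lam1 n) (lam2 n) (β n))
    have hHtop : conj G ((M n).conjArg (lam1 n) (lam2 n) (β n)) ≠ ⊤ := fun h =>
      (M n).mstar_ne_top h1.le h2 hβ h3 h4 ((M n).mstar_eq_top h0 h)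
    have hv := (M n).conjArg_ne_top h3
    refine ⟨_, (conj G ((M n).conjArg (lam1 n) (lam2 n) (β n))).toReal,
      ENNReal.toReal_pos ((M n).conjArg_pos h1 h2 hβ).ne' hv, EReal.toReal_nonneg hH,
      Eventually.of_forall fun _ _ u hu => fenchel_young hv (EReal.le_coe_toReal hHtop) hu⟩
  · refine ⟨1, 0, one_pos, le_rfl, ?_⟩
    filter_upwards [not_frequently.1 hfreq] with n hn h
    exact absurd h hn

theorem conjArg_zero {n p : ℕ} {Ω 𝒳 : Type*} [MeasurableSpace Ω] [MeasurableSpace 𝒳]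
    (M : Setup n p Ω 𝒳) (lam1 lam2 : ℝ) : M.conjArg lam1 lam2 0 = 0 := by
  simp [conjArg, supp, l2]

/-- The linearized margin inequality at the argument of the conjugate. -/
theorem conjArg_mul_nrm_le {n p : ℕ} {Ω 𝒳 : Type*} [MeasurableSpace Ω] [MeasurableSpace 𝒳]
    (M : Setup n p Ω 𝒳) {G : ℝ → ℝ} {η lam1 lam2 c C : ℝ} {β : Fin p → ℝ} (htarget : M.IsTarget)
    (hmargin : M.Margin η G) (hc : 0 < c)
    (hG : β ≠ 0 → ∀ u, 0 ≤ u → c * u ≤ G u + C) (hvc : (M.conjArg lam1 lam2 β).toReal ≤ c)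
    {f : M.F} (hf : f ∈ M.Flocal η) :
    (M.conjArg lam1 lam2 β).toReal * M.nrm (f - M.f0)
      ≤ M.excess f + (M.conjArg lam1 lam2 β).toReal * (C / c) := by
  have hX : 0 ≤ M.excess f := sub_nonneg.2 (htarget f)
  by_cases hβ : β = 0
  · rw [hβ, conjArg_zero]; simpa using hX
  set v := (M.conjArg lam1 lam2 β).toReal with hv
  have hv0 : 0 ≤ v := ENNReal.toReal_nonneg
  have h1 := hG hβ (M.nrm (f - M.f0)) (apply_nonneg _ _)
  have h2 := hmargin f hf
  have h3 : v * M.nrm (f - M.f0) = v / c * (c * M.nrm (f - M.f0)) := by field_simp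
  have h4 : v / c ≤ 1 := (div_le_one hc).2 hvc
  have h5 : 0 ≤ v / c := by positivity
  have h6 : v * (C / c) = v / c * C := by ring
  rw [h3, h6]
  nlinarith [mul_le_mul_of_nonneg_left (h1.trans (add_le_add_left h2 C)) h5]

/-- The tuning gives `4λ₂‖β‖₂ = 2λ₁√s`, so the argument is at most `6Lλ₀√s/κ`, and `λ₀² s` is a
constant times `(log p / n) s`. -/
theorem tendsto_conjArg {a b L d D κ : ℝ} (ha : 0 < a) (hab : a + b < 1) (hκ : 0 < κ)
    {p : ℕ → ℕ} (hp : Tendsto p atTop atTop)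
    (hpO : (fun n => (p n : ℝ)) =O[atTop] fun n : ℕ => Real.exp ((n : ℝ) ^ a))
    {Ω 𝒳 : ℕ → Type*} [∀ n, MeasurableSpace (Ω n)] [∀ n, MeasurableSpace (𝒳 n)]
    (M : ∀ n, Setup n (p n) (Ω n) (𝒳 n)) {lam1 lam2 : ℕ → ℝ} {β : ∀ n, Fin (p n) → ℝ}
    (hl0 : ∀ᶠ n in atTop, 0 < lambda0 d D n (p n))
    (hl1 : ∀ᶠ n in atTop, 0 < lam1 n)
    (hl1' : ∀ᶠ n in atTop, lam1 n ≤ L * lambda0 d D n (p n))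
    (hl2 : ∀ᶠ n in atTop, 0 ≤ lam2 n)
    (htune : ∀ᶠ n in atTop,
      lam2 n * (2 * l2 (β n)) = lam1 n * Real.sqrt ((supp (β n)).card : ℝ))
    (hs : (fun n => ((supp (β n)).card : ℝ)) =O[atTop] fun n : ℕ => (n : ℝ) ^ b)
    (hφ : ∀ᶠ n in atTop, ENNReal.ofReal κ ≤ (M n).phi (lam1 n) (lam2 n) (β n)) :
    Tendsto (fun n => ((M n).conjArg (lam1 n) (lam2 n) (β n)).toReal) atTop (𝓝 0) := by
  have h1 : Tendsto (fun n : ℕ => 6 * L / κ * Real.sqrt (d ^ 2 * D ^ 2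
      * (Real.log (p n) / n * (supp (β n)).card))) atTop (𝓝 0) := by
    have h2 := tendsto_log_div_mul_sparsity ha hab hp hpO hs
    have h3 := ((Real.continuous_sqrt.tendsto _).comp
      (h2.const_mul (d ^ 2 * D ^ 2))).const_mul (6 * L / κ)
    simpa using h3
  refine squeeze_zero' (Eventually.of_forall fun _ => ENNReal.toReal_nonneg) ?_ h1
  filter_upwards [hl0, hl1, hl1', hl2, htune, hφ, hp.eventually_ge_atTop 1]
    with n g0 g1 g1' g2 g3 g4 g5
  refine ((M n).conjArg_toReal_le hκ g1.le g2 g4).trans ?_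
  have h2 : Real.sqrt (d ^ 2 * D ^ 2 * (Real.log (p n) / n * (supp (β n)).card))
      = lambda0 d D n (p n) * Real.sqrt ((supp (β n)).card : ℝ) := by
    rw [← mul_assoc, ← lambda0_sq g5, Real.sqrt_mul (sq_nonneg _), Real.sqrt_sq g0.le]
  rw [h2, div_mul_eq_mul_div]
  refine div_le_div_of_nonneg_right ?_ hκ.le
  have h3 := mul_le_mul_of_nonneg_right g1' (Real.sqrt_nonneg ((supp (β n)).card : ℝ))
  nlinarith

end Setup

end ElasticNet

/-! ### Passage to the limit -/

theorem corollary1 (K : ℝ) (hK : 0 < K) :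
    ∃ d₀ : ℝ, 0 < d₀ ∧ ∀ d : ℝ, d₀ ≤ d →
    ∀ (D : ℝ) (_ : 0 < D) (L : ℝ) (_ : 8 ≤ L)
      (a b : ℝ) (_ : 0 < a) (_ : 0 ≤ b) (_ : a + b < 1)
      (G : ℝ → ℝ) (_ : StrictConvexOn ℝ (Set.Ici 0) G) (_ : G 0 = 0)
      (p : ℕ → ℕ)
      (_ : Tendsto p atTop atTop)
      (_ : (fun n => (p n : ℝ)) =O[atTop] fun n : ℕ => Real.exp ((n : ℝ) ^ a))
      (Ω : ℕ → Type*) (𝒳 : ℕ → Type*)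
      [∀ n, MeasurableSpace (Ω n)] [∀ n, MeasurableSpace (𝒳 n)]
      (M : ∀ n, ElasticNet.Setup n (p n) (Ω n) (𝒳 n))
      (η lam1 lam2 : ℕ → ℝ)
      (βstar : ∀ n, Fin (p n) → ℝ) (βhat : ∀ n, Ω n → Fin (p n) → ℝ)
      -- the target, the estimator, and the oracle
      (_ : ∀ᶠ n in atTop, (M n).IsTarget)
      (_ : ∀ᶠ n in atTop, ∀ᵐ ω ∂(M n).P, (M n).IsElasticNet (lam1 n) (lam2 n) ω (βhat n ω))
      (_ : ∀ᶠ n in atTop, (M n).IsOracle G (lam1 n) (lam2 n) (βstar n))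
      -- the tuning parameters
      (_ : ∀ᶠ n in atTop, 8 * ElasticNet.lambda0 d D n (p n) ≤ lam1 n)
      (_ : ∀ᶠ n in atTop, lam1 n ≤ L * ElasticNet.lambda0 d D n (p n))
      (_ : ∀ᶠ n in atTop, 0 ≤ lam2 n)
      (_ : ∀ᶠ n in atTop, lam2 n * (2 * ElasticNet.l2 (βstar n)) =
        lam1 n * Real.sqrt ((ElasticNet.supp (βstar n)).card : ℝ))
      -- the margin condition and the location of the oracle
      (_ : ∀ᶠ n in atTop, 0 < η n)
      (_ : ∀ᶠ n in atTop, (M n).Margin (η n) G)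
      (_ : ∀ᶠ n in atTop, (M n).LocalOracle (η n) G (ElasticNet.lambda0 d D n (p n))
        (lam1 n) (lam2 n) (βstar n))
      -- a norm; a seminorm is allowed when the oracle rate is positive
      (_ : ∀ᶠ n in atTop, (M n).IsNorm ∨
        0 < (M n).Mstar G (ElasticNet.lambda0 d D n (p n)) (lam1 n) (lam2 n) (βstar n))
      -- the Lipschitz loss and the basis functions
      (_ : ∀ᶠ n in atTop, (M n).LipschitzLoss D)
      (_ : ∀ᶠ n in atTop, (M n).SecondMoment)
      (_ : ∀ᶠ n in atTop, (M n).BoundedBasis K)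
      -- the sparsity of the oracle, and its restricted eigenvalue
      (_ : (fun n => ((ElasticNet.supp (βstar n)).card : ℝ)) =O[atTop] fun n : ℕ => (n : ℝ) ^ b)
      (_ : ∃ κ : ℝ, 0 < κ ∧ ∀ᶠ n in atTop,
        ENNReal.ofReal κ ≤ (M n).phi (lam1 n) (lam2 n) (βstar n)),
    -- with probability tending to one, the excess risk is of the order of the oracle's
    ∃ A : ∀ n, Set (Ω n), (∀ n, MeasurableSet (A n)) ∧
      Tendsto (fun n => (M n).P (A n)) atTop (𝓝 1) ∧
      ∀ ω : ∀ n, Ω n, (∀ᶠ n in atTop, ω n ∈ A n) →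
        limsup (fun n => (((M n).excess ((M n).lin (βhat n (ω n))) : ℝ) : EReal)) atTop
          ≤ 6 * limsup (fun n => (((M n).excess ((M n).lin (βstar n)) : ℝ) : EReal)) atTop := by
  refine ⟨4 * K, by positivity, ?_⟩
  intro d hd D hD L hL a b ha hb hab G hG hG0 p hp hpO Ω 𝒳 _ _ M η lam1 lam2 βstar βhat
    htarget hnet horacle hl1 hl1' hl2 htune hη hmargin hloc hnorm hlip _ hbdd hs hκ
  obtain ⟨κ, hκ, hφ⟩ := hκ
  have hd0 : 0 < d := by linarith
  have hl0 : ∀ᶠ n in atTop, 0 < ElasticNet.lambda0 d D n (p n) := by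
    filter_upwards [eventually_gt_atTop 0, hp.eventually_ge_atTop 2] with n h1 h2
    exact ElasticNet.lambda0_pos hd0 hD h1 h2
  have hl1pos : ∀ᶠ n in atTop, 0 < lam1 n := by
    filter_upwards [hl0, hl1] with n h1 h2
    linarith
  have hφ0 : ∀ᶠ n in atTop, (M n).phi (lam1 n) (lam2 n) (βstar n) ≠ 0 := by
    filter_upwards [hφ] with n h1
    exact ((ENNReal.ofReal_pos.2 hκ).trans_le h1).ne'
  obtain ⟨c, C, hc, hC, hlin⟩ :=
    ElasticNet.Setup.exists_linear_lower_bound hG0 M hl0 hl1pos hl2 hφ0 hloc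
  have hv := ElasticNet.Setup.tendsto_conjArg ha hab hκ hp hpO M hl0 hl1pos hl1' hl2
    htune hs hφ
  set v : ℕ → ℝ := fun n => ((M n).conjArg (lam1 n) (lam2 n) (βstar n)).toReal with hvdef
  set δ : ℕ → ℝ := fun n => 4 * (v n * (C / c) + 1 / ((n : ℝ) + 1)) with hδdef
  have hδ : Tendsto δ atTop (𝓝 0) := by
    have h1 : Tendsto δ atTop (𝓝 (4 * (0 * (C / c) + 0))) :=
      ((hv.mul_const (C / c)).add tendsto_one_div_add_atTop_nhds_zero_nat).const_mul 4
    simpa using h1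
  -- The hypotheses hold only for large `n`, but events are required for every `n`; the whole space
  -- serves as default.
  have hevent : ∀ n, ∃ A : Set (Ω n), MeasurableSet A ∧
      ((∃ A : Set (Ω n), MeasurableSet A ∧ (M n).P Aᶜ ≤ ENNReal.ofReal (2 / p n) ∧
        ∀ ω ∈ A, (M n).excess ((M n).lin (βhat n ω))
          ≤ 6 * (M n).excess ((M n).lin (βstar n)) + δ n) →
      (M n).P Aᶜ ≤ ENNReal.ofReal (2 / p n) ∧
        ∀ ω ∈ A, (M n).excess ((M n).lin (βhat n ω))
          ≤ 6 * (M n).excess ((M n).lin (βstar n)) + δ n) := fun n => by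
    by_cases h : ∃ A : Set (Ω n), MeasurableSet A ∧ (M n).P Aᶜ ≤ ENNReal.ofReal (2 / p n) ∧
        ∀ ω ∈ A, (M n).excess ((M n).lin (βhat n ω))
          ≤ 6 * (M n).excess ((M n).lin (βstar n)) + δ n
    · obtain ⟨A, hA, h1⟩ := h
      exact ⟨A, hA, fun _ => h1⟩
    · exact ⟨Set.univ, MeasurableSet.univ, fun h' => absurd h' h⟩
  choose A hA hAevent using hevent
  have hgood : ∀ᶠ n in atTop, (M n).P (A n)ᶜ ≤ ENNReal.ofReal (2 / p n) ∧
      ∀ ω ∈ A n, (M n).excess ((M n).lin (βhat n ω))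
        ≤ 6 * (M n).excess ((M n).lin (βstar n)) + δ n := by
    filter_upwards [htarget, hnet, horacle, hl1, hl2, hη, hmargin, hloc, hnorm, hlip, hbdd, hl0,
      hφ0, hlin, hv.eventually (eventually_le_nhds hc), eventually_gt_atTop 0,
      hp.eventually_ge_atTop 1]
      with n g1 g2 g3 g4 g5 g6 g7 g8 g9 g10 g11 g12 g13 g14 g15 g16 g17
    refine hAevent n ?_
    obtain ⟨B, hB, hPB, hBω⟩ := (M n).exists_event_excess_le hG hG0 (ε := 1 / ((n : ℝ) + 1))
      (e := v n * (C / c)) hD hK g6 g16 g17 g12 g4 g5 (by positivity)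
      (mul_nonneg ENNReal.toReal_nonneg (by positivity)) g1 g3.1 g2 g13 g7 g8 g9 g11 g10
      fun f hf => (M n).conjArg_mul_nrm_le g1 g7 hc g14 g15 hf
    exact ⟨B, hB, hPB.trans (ENNReal.ofReal_le_ofReal
      (ElasticNet.two_mul_exp_neg_le hK hD hd g16 g17)), hBω⟩
  refine ⟨A, hA, ?_, fun ω hω => ?_⟩
  · have h1 : Tendsto (fun n => ENNReal.ofReal (2 / p n)) atTop (𝓝 0) := by
      have h2 : Tendsto (fun n => (2 : ℝ) / p n) atTop (𝓝 0) :=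
        (tendsto_natCast_atTop_atTop.comp hp).const_div_atTop 2
      simpa using ENNReal.tendsto_ofReal h2
    have h2 : Tendsto (fun n => 1 - ENNReal.ofReal (2 / p n)) atTop (𝓝 1) := by
      simpa using ENNReal.Tendsto.sub tendsto_const_nhds h1 (Or.inl ENNReal.one_ne_top)
    refine tendsto_of_tendsto_of_tendsto_of_le_of_le' h2 tendsto_const_nhds ?_ ?_
    · filter_upwards [hgood] with n hn
      have := (M n).isProb
      rw [tsub_le_iff_right, ← prob_add_prob_compl (μ := (M n).P) (hA n)]
      exact add_le_add_right hn.1 _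
    · exact Eventually.of_forall fun n => by
        have := (M n).isProb
        exact prob_le_one
  · refine ElasticNet.limsup_coe_le_of_eventually_le ?_ hδ
    filter_upwards [hgood, hω] with n h1 h2
    exact h1.2 _ h2
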